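/- Let $\gamma>0$ and let $V:(\mathbb{R}/\mathbb{Z})^2\to\mathbb{R}$ be piecewise $\gamma$-Hölder continuous with respect to the second variable, that is, $V$ is measurable and there are $0=a_1<a_2<\cdots<a_m=1$ such that $$\sup_{(x,y)}|V(x,y)|+\sup_{x\in\mathbb{R}/\mathbb{Z}}\ \sup_{1\le i\le m-1}\ \sup_{y_1\ne y_2\in[a_i,a_{i+1}]}\frac{|V(x,y_1)-V(x,y_2)|}{|y_1-y_2|^{\gamma}}<\infty .$$ Let $\omega\in\mathbb{R}$ and consider on $L^2(\mathbb{R})$ the Schrödinger operator $$(Hu)(x)=-u''(x)+V(x,\omega x)\,u(x).$$ For $\theta\in\mathbb{R}/\mathbb{Z}$ and $E\in\mathbb{R}$ let $T_\theta(E,y,x)$ be the transfer matrix of the equation $-u''(x)+V(x,\theta+\omega x)u(x)=Eu(x)$, that is, the $2\times2$ matrix that maps $(u'(y),u(y))^{T}$ to $(u'(x),u(x))^{T}$ for every solution $u$ (solutions are differentiable with locally absolutely continuous derivative and satisfy the equation almost everywhere), and let $$L(E)=\lim_{x\to\infty}\frac1x\int_{\mathbb{R}/\mathbb{Z}}\ln\|T_\theta(E,0,x)\|\,d\theta$$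 be the Lyapunov exponent. Let $$\beta(\omega)=\limsup_{k\to\infty}\frac{-\ln\|k\omega\|}{k}\in[0,\infty],$$ where $\|t\|=\operatorname{dist}(t,\mathbb{Z})$ and $-\ln 0=+\infty$. Then $H$ has no eigenvalue in $\{E\in\mathbb{R}: L(E)<\gamma\beta(\omega)\}$: if $E$ is in this set, then there is no nonzero $u\in L^2(\mathbb{R})$, differentiable with locally absolutely continuous derivative, such that $Hu=Eu$ almost everywhere. -/

import Mathlib

open MeasureTheory Filter Topology
open scoped Matrix.Norms.L2Operator

noncomputable section

/-- The class `A_γ`: measurable functions on the two-torus that are bounded and, on each of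
finitely many closed intervals `[a_i, a_{i+1}]` partitioning `[0, 1]`, `γ`-Hölder continuous in the
second variable, uniformly in the first. -/
def PiecewiseHolder (γ : ℝ) (V : UnitAddCircle × UnitAddCircle → ℝ) : Prop :=
  Measurable V ∧
    ∃ (n : ℕ) (a : Fin (n + 1) → ℝ), StrictMono a ∧ a 0 = 0 ∧ a (Fin.last n) = 1 ∧
      ∃ C : ℝ, (∀ p, |V p| ≤ C) ∧
        ∀ (x : UnitAddCircle) (i : Fin n),
          ∀ y₁ ∈ Set.Icc (a i.castSucc) (a i.succ), ∀ y₂ ∈ Set.Icc (a i.castSucc) (a i.succ),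
            |V (x, (y₁ : UnitAddCircle)) - V (x, (y₂ : UnitAddCircle))| ≤ C * |y₁ - y₂| ^ γ

/-- The potential `t ↦ V (t, θ + ω t)` on the line, with phase `θ`. -/
def quasiPotential (V : UnitAddCircle × UnitAddCircle → ℝ) (ω : ℝ) (θ : UnitAddCircle) (t : ℝ) :
    ℝ :=
  V ((t : UnitAddCircle), θ + ((ω * t : ℝ) : UnitAddCircle))

/-- `u` solves `-u'' + W u = E u` on the line: `u` is differentiable, `u'` is locally absolutely
continuous, and the equation holds almost everywhere. -/
structure IsSolution {𝕜 : Type} [RCLike 𝕜] (W : ℝ → ℝ) (E : ℝ) (u : ℝ → 𝕜) : Prop where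
  differentiable : Differentiable ℝ u
  deriv_ac : ∀ a b : ℝ, AbsolutelyContinuousOnInterval (deriv u) a b
  equation : ∀ᵐ x : ℝ, -deriv (deriv u) x + (W x : 𝕜) * u x = (E : 𝕜) * u x

/-- `E` is an eigenvalue of the Schrödinger operator `-d²/dx² + W` on `L²(ℝ)`. -/
def IsSchrodingerEigenvalue (W : ℝ → ℝ) (E : ℝ) : Prop :=
  ∃ u : ℝ → ℂ, IsSolution W E u ∧ MemLp u 2 volume ∧ u ≠ 0

/-- `T` maps the data `(u'(y), u(y))` of every solution to the data `(u'(x), u(x))`. -/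
def IsTransferMatrix (W : ℝ → ℝ) (E y x : ℝ) (T : Matrix (Fin 2) (Fin 2) ℝ) : Prop :=
  ∀ u : ℝ → ℝ, IsSolution W E u → T.mulVec ![deriv u y, u y] = ![deriv u x, u x]

/-- The transfer matrix `T(E, y, x)`. For bounded measurable `W` there is exactly one matrix with
the property `IsTransferMatrix`. -/
def transferMatrix (W : ℝ → ℝ) (E y x : ℝ) : Matrix (Fin 2) (Fin 2) ℝ :=
  Classical.epsilon (IsTransferMatrix W E y x)

/-- The Lyapunov exponent
`L(E) = lim_{x → ∞} (1 / x) ∫ log ‖T_θ(E, 0, x)‖ dθ`, where `T_θ` is the transfer matrix for the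
potential with phase `θ` (operator norm for the Euclidean norm). -/
def lyapunovExponent (V : UnitAddCircle × UnitAddCircle → ℝ) (ω E : ℝ) : ℝ :=
  limUnder atTop fun x : ℝ =>
    (1 / x) * ∫ θ : UnitAddCircle, Real.log ‖transferMatrix (quasiPotential V ω θ) E 0 x‖

/-- `β(ω) = limsup_{k → ∞} -log ‖k ω‖ / k`, where `‖·‖` is the distance to the nearest integer, as
an extended real, with `log 0 = -∞`. -/
def liouvilleExponent (ω : ℝ) : EReal :=
  limsup (fun k : ℕ =>
    -ENNReal.log (ENNReal.ofReal ‖((k * ω : ℝ) : UnitAddCircle)‖) / ((k : ℝ) : EReal)) atTop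

end

/-! The proof is Gordon's three-block argument, with the Lyapunov exponent controlling the error.
Cayley–Hamilton for the determinant-one transfer matrix over `[0, k]` bounds the data `(u', u)` at
`0` by the data at `-k`, `k` and `2k`, provided the transfer matrices over `[-k, 0]` and `[k, 2k]`
are close to it (`gordon_estimate`). An `L²` solution and its derivative tend to zero at both ends
(`IsSolution.tendsto_zero`). If closeness holds for arbitrarily large `k`, the data at `0` therefore
vanish, and so does the solution.

Closeness comes from arithmetic. As `V` has period one in its first variable, an integer shift by
`k` only moves the phase by `kω`, so transfer matrices over integer lengths form a cocycle `A` over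
the rotation by `ω`. Telescoping (`IsHolderCocycle.norm_sub_le`) bounds `‖A k (±kω) - A k 0‖` by a
constant times `k e^{L'k} ‖kω‖^γ`, once `‖A n θ‖ ≤ K e^{L'n}` for all phases at once. For irrational
`ω` this holds for every `L' > L(E)` (`IsHolderCocycle.exists_norm_le_mul_exp`), because Birkhoff
averages of the continuous functions `log ‖A n ·‖` converge uniformly. Choosing `L(E) < L' < γb`
with `b < β(ω)`, infinitely many `k` satisfy `‖kω‖ < e^{-bk}`, and the bound decays along them. For
rational `ω` the blocks repeat exactly at multiples of the period.

Discontinuities play no role: the pieces are closed intervals sharing endpoints, so the potential is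
Hölder on the whole circle (`PiecewiseHolder.exists_holder`). -/

/-! ### Grönwall estimates -/

/-- Integral form of Grönwall's inequality. -/
theorem le_mul_exp_of_le_add_integral {φ : ℝ → ℝ} (hφ : Continuous φ) (h0 : ∀ x, 0 ≤ φ x)
    {K η X : ℝ} (hK : 0 < K)
    (h : ∀ x ∈ Set.Icc 0 X, φ x ≤ η + K * ∫ t in (0 : ℝ)..x, φ t) :
    ∀ x ∈ Set.Icc 0 X, φ x ≤ η * Real.exp (K * x) := by
  intro x hx
  have hd : ∀ y, HasDerivAt (fun z => ∫ t in (0 : ℝ)..z, φ t) (φ y) y := fun y =>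
    intervalIntegral.integral_hasDerivAt_right (hφ.intervalIntegrable _ _)
      (hφ.stronglyMeasurableAtFilter _ _) hφ.continuousAt
  have hnn : ∀ y ∈ Set.Icc 0 X, 0 ≤ ∫ t in (0 : ℝ)..y, φ t := fun y hy =>
    intervalIntegral.integral_nonneg hy.1 fun t _ => h0 t
  -- The differential form is applied to the primitive of `φ`, which starts at `0`; feeding the
  -- result back into `h` bounds `φ` itself.
  have key := norm_le_gronwallBound_of_norm_deriv_right_le (f := fun z => ∫ t in (0 : ℝ)..z, φ t)
    (f' := φ) (δ := 0) (K := K) (ε := η) (a := 0) (b := X)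
    (fun y _ => (hd y).continuousAt.continuousWithinAt) (fun y _ => (hd y).hasDerivWithinAt)
    (by simp) (fun y hy => by
      have hy' : y ∈ Set.Icc 0 X := ⟨hy.1, hy.2.le⟩
      rw [Real.norm_of_nonneg (h0 y), Real.norm_of_nonneg (hnn y hy')]
      linarith [h y hy']) x hx
  rw [Real.norm_of_nonneg (hnn x hx), gronwallBound_of_K_ne_0 hK.ne', sub_zero] at key
  simp only [zero_mul, zero_add] at key
  have h1 := h x hx
  have h2 : K * (η / K * (Real.exp (K * x) - 1)) = η * Real.exp (K * x) - η := by
    field_simp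
  nlinarith [mul_le_mul_of_nonneg_left key hK.le]

theorem abs_add_abs_le_of_integral_bounds {u p : ℝ → ℝ} (hu : Continuous u) (hp : Continuous p)
    {M a c X : ℝ} (hM : 0 ≤ M)
    (h₁ : ∀ x ∈ Set.Icc 0 X, |u x| ≤ a + ∫ t in (0 : ℝ)..x, |p t|)
    (h₂ : ∀ x ∈ Set.Icc 0 X, |p x| ≤ c + M * ∫ t in (0 : ℝ)..x, |u t|) :
    ∀ x ∈ Set.Icc 0 X, |u x| + |p x| ≤ (a + c) * Real.exp ((1 + M) * x) := by
  refine le_mul_exp_of_le_add_integral (φ := fun x => |u x| + |p x|) (by fun_prop)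
    (fun x => by positivity) (by linarith) fun x hx => ?_
  have hi : ∀ f : ℝ → ℝ, Continuous f → IntervalIntegrable (fun t => |f t|) volume 0 x :=
    fun f hf => hf.abs.intervalIntegrable _ _
  rw [intervalIntegral.integral_add (hi u hu) (hi p hp)]
  have h3 : 0 ≤ ∫ t in (0 : ℝ)..x, |u t| :=
    intervalIntegral.integral_nonneg hx.1 fun t _ => abs_nonneg _
  have h4 : 0 ≤ ∫ t in (0 : ℝ)..x, |p t| :=
    intervalIntegral.integral_nonneg hx.1 fun t _ => abs_nonneg _
  nlinarith [h₁ x hx, h₂ x hx, mul_nonneg hM h4]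

theorem abs_integral_mul_le {g u : ℝ → ℝ} {M x : ℝ} (hx : 0 ≤ x) (hg : ∀ t, |g t| ≤ M)
    (hu : Continuous u) : |∫ t in (0 : ℝ)..x, g t * u t| ≤ M * ∫ t in (0 : ℝ)..x, |u t| := by
  rw [← intervalIntegral.integral_const_mul, ← Real.norm_eq_abs]
  refine intervalIntegral.norm_integral_le_of_norm_le hx (ae_of_all _ fun t _ => ?_)
    ((hu.abs.const_smul M).intervalIntegrable (μ := volume) _ _)
  rw [Real.norm_eq_abs, abs_mul]
  exact mul_le_mul_of_nonneg_right (hg t) (abs_nonneg _)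

/-! ### Solutions as integral equations; growth and dependence on the potential -/

section Solutions

variable {W : ℝ → ℝ} {E M : ℝ} {u : ℝ → ℝ}

theorem IsSolution.continuous (hu : IsSolution W E u) : Continuous u :=
  hu.differentiable.continuous

theorem IsSolution.continuous_deriv {𝕜 : Type} [RCLike 𝕜] {u : ℝ → 𝕜} (hu : IsSolution W E u) :
    Continuous (deriv u) := by
  refine continuous_iff_continuousAt.2 fun x => ?_
  have h := (hu.deriv_ac (x - 1) (x + 1)).continuousOn
  refine h.continuousAt ?_
  rw [Set.uIcc_of_le (by linarith)]
  exact Icc_mem_nhds (by linarith) (by linarith)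

theorem IsSolution.apply_eq (hu : IsSolution W E u) (a x : ℝ) :
    u x = u a + ∫ t in a..x, deriv u t := by
  rw [intervalIntegral.integral_deriv_eq_sub (fun t _ => hu.differentiable t)
    (hu.continuous_deriv.intervalIntegrable _ _)]
  ring

theorem IsSolution.deriv_eq (hu : IsSolution W E u) (a x : ℝ) :
    deriv u x = deriv u a + ∫ t in a..x, (W t - E) * u t := by
  have h := (hu.deriv_ac a x).integral_deriv_eq_sub
  rw [← intervalIntegral.integral_congr_ae (f := deriv (deriv u)), h]
  · ring
  · filter_upwards [hu.equation] with t ht _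
    simp only [RCLike.ofReal_real_eq_id, id] at ht
    linarith

theorem intervalIntegrable_mul_of_bounded (hW : Measurable W) (hM : ∀ t, |W t - E| ≤ M)
    (hu : Continuous u) (a b : ℝ) :
    IntervalIntegrable (fun t => (W t - E) * u t) volume a b := by
  refine IntervalIntegrable.mono_fun' ((hu.abs.const_smul M).intervalIntegrable a b)
    (((hW.sub_const E).mul hu.measurable).aestronglyMeasurable) (ae_of_all _ fun t => ?_)
  simp only [norm_mul, Real.norm_eq_abs, Pi.smul_apply, smul_eq_mul]
  exact mul_le_mul_of_nonneg_right (hM t) (abs_nonneg _)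

theorem isSolution_of_integral (hW : Measurable W) (hM : ∀ t, |W t - E| ≤ M) {p : ℝ → ℝ}
    (hu : ∀ x, HasDerivAt u (p x) x)
    (hp : ∀ x, p x = p 0 + ∫ t in (0 : ℝ)..x, (W t - E) * u t) : IsSolution W E u := by
  have hdu : deriv u = p := funext fun x => (hu x).deriv
  have hc : Continuous u := continuous_iff_continuousAt.2 fun x => (hu x).continuousAt
  have hi := intervalIntegrable_mul_of_bounded hW hM hc
  have hp' : p = fun x => p 0 + ∫ t in (0 : ℝ)..x, (W t - E) * u t := funext hp
  refine ⟨fun x => (hu x).differentiableAt, fun a b => ?_, ?_⟩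
  · rw [hdu, hp']
    set R := max |a| |b|
    have hR : 0 ≤ R := (abs_nonneg a).trans (le_max_left _ _)
    -- The base point `0` need not lie between `a` and `b`, hence the detour through a symmetric
    -- interval.
    have h0 := (hi (-R) R).absolutelyContinuousOnInterval_intervalIntegral (c := 0)
      (by rw [Set.uIcc_of_le (by linarith)]; exact ⟨by linarith, hR⟩)
    have h1 := h0.mono (c := a) (d := b) (by
      rw [Set.uIcc_of_le (by linarith : -R ≤ R)]
      refine Set.uIcc_subset_Icc ⟨?_, ?_⟩ ⟨?_, ?_⟩
      · linarith [neg_abs_le a, le_max_left |a| |b|]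
      · linarith [le_abs_self a, le_max_left |a| |b|]
      · linarith [neg_abs_le b, le_max_right |a| |b|]
      · linarith [le_abs_self b, le_max_right |a| |b|])
    have h2 : AbsolutelyContinuousOnInterval (fun _ : ℝ => p 0) a b :=
      (contDiff_const (n := 1)).contDiffOn.absolutelyContinuousOnInterval
    exact h2.add h1
  · have hl : LocallyIntegrable (fun t => (W t - E) * u t) volume := by
      refine (locallyIntegrable_iff).2 fun k hk => ?_
      obtain ⟨R, hR⟩ := hk.isBounded.subset_closedBall 0
      have := hi (-R) R
      by_cases hRn : 0 ≤ R
      · rw [intervalIntegrable_iff_integrableOn_Icc_of_le (by linarith)] at this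
        refine this.mono_set (hR.trans ?_)
        rw [Real.closedBall_eq_Icc]; simp
      · rw [Metric.closedBall_eq_empty.2 (by linarith)] at hR
        rw [Set.subset_empty_iff.1 hR]; simp
    filter_upwards [LocallyIntegrable.ae_hasDerivAt_integral hl] with x hx
    have h3 : HasDerivAt p ((W x - E) * u x) x := by
      rw [hp']; exact (hx 0).const_add _
    rw [hdu, h3.deriv]
    simp only [RCLike.ofReal_real_eq_id, id]
    ring

theorem IsSolution.linear_combination (hW : Measurable W) (hM : ∀ t, |W t - E| ≤ M)
    {v : ℝ → ℝ} (hu : IsSolution W E u) (hv : IsSolution W E v) (a b : ℝ) :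
    IsSolution W E (fun x => a * u x + b * v x) := by
  refine isSolution_of_integral hW hM (p := fun x => a * deriv u x + b * deriv v x)
    (fun x => (((hu.differentiable x).hasDerivAt.const_mul a).add
      ((hv.differentiable x).hasDerivAt.const_mul b))) fun x => ?_
  have h : (fun t => (W t - E) * (a * u t + b * v t)) =
      fun t => a * ((W t - E) * u t) + b * ((W t - E) * v t) := by ext; ring
  rw [h, intervalIntegral.integral_add
    ((intervalIntegrable_mul_of_bounded hW hM hu.continuous _ _).const_mul a)
    ((intervalIntegrable_mul_of_bounded hW hM hv.continuous _ _).const_mul b),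
    intervalIntegral.integral_const_mul, intervalIntegral.integral_const_mul,
    hu.deriv_eq 0 x, hv.deriv_eq 0 x]
  ring

theorem IsSolution.abs_le (hM : ∀ t, |W t - E| ≤ M) (hu : IsSolution W E u) {x : ℝ}
    (hx : 0 ≤ x) :
    |u x| + |deriv u x| ≤ (|u 0| + |deriv u 0|) * Real.exp ((1 + M) * x) := by
  have hM0 : 0 ≤ M := (abs_nonneg _).trans (hM 0)
  refine abs_add_abs_le_of_integral_bounds hu.continuous hu.continuous_deriv hM0
    (fun y hy => ?_) (fun y hy => ?_) x ⟨hx, le_rfl⟩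
  · rw [hu.apply_eq 0 y]
    exact (abs_add_le _ _).trans (by
      gcongr; exact intervalIntegral.abs_integral_le_integral_abs hy.1)
  · rw [hu.deriv_eq 0 y]
    exact (abs_add_le _ _).trans (by
      gcongr; exact abs_integral_mul_le hy.1 hM hu.continuous)

/-- The difference solves the equation for `W` with forcing term `(W - W') v` and zero initial data.
One exponential comes from the growth of `v` inside the forcing, the other from Grönwall's
inequality. -/
theorem IsSolution.abs_sub_le {W' : ℝ → ℝ} {δ : ℝ} (hW : Measurable W) (hW' : Measurable W')
    (hM : ∀ t, |W t - E| ≤ M)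
    (hM' : ∀ t, |W' t - E| ≤ M) (hδ : ∀ t, |W t - W' t| ≤ δ) {v : ℝ → ℝ}
    (hu : IsSolution W E u) (hv : IsSolution W' E v) (h0 : u 0 = v 0)
    (h0' : deriv u 0 = deriv v 0) {x : ℝ} (hx : 0 ≤ x) :
    |u x - v x| + |deriv u x - deriv v x| ≤
      δ * (x * (|v 0| + |deriv v 0|) * Real.exp ((1 + M) * x) * Real.exp ((1 + M) * x)) := by
  have hM0 : 0 ≤ M := (abs_nonneg _).trans (hM 0)
  have hδ0 : 0 ≤ δ := (abs_nonneg _).trans (hδ 0)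
  have := abs_add_abs_le_of_integral_bounds (hu.continuous.sub hv.continuous)
    (hu.continuous_deriv.sub hv.continuous_deriv) hM0 (a := 0) (X := x)
    (c := δ * (x * (|v 0| + |deriv v 0|) * Real.exp ((1 + M) * x)))
    (fun y hy => ?_) (fun y hy => ?_) x ⟨hx, le_rfl⟩
  · simpa [mul_assoc] using this
  · rw [zero_add]
    refine le_trans (le_of_eq ?_) (intervalIntegral.abs_integral_le_integral_abs hy.1)
    simp only [Pi.sub_apply]
    rw [intervalIntegral.integral_sub (hu.continuous_deriv.intervalIntegrable _ _)
      (hv.continuous_deriv.intervalIntegrable _ _), hu.apply_eq 0 y, hv.apply_eq 0 y, h0]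
    ring_nf
  · have h1 : deriv u y - deriv v y = (∫ t in (0 : ℝ)..y, (W t - W' t) * v t) +
        ∫ t in (0 : ℝ)..y, (W t - E) * (u t - v t) := by
      have i1 := intervalIntegrable_mul_of_bounded hW hM hu.continuous 0 y
      have i2 := intervalIntegrable_mul_of_bounded hW hM hv.continuous 0 y
      have i3 := intervalIntegrable_mul_of_bounded hW' hM' hv.continuous 0 y
      have e1 : (fun t => (W t - W' t) * v t) = fun t => (W t - E) * v t - (W' t - E) * v t := by
        ext; ring
      have e2 : (fun t => (W t - E) * (u t - v t)) =
          fun t => (W t - E) * u t - (W t - E) * v t := by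
        ext; ring
      rw [hu.deriv_eq 0 y, hv.deriv_eq 0 y, h0', e1, e2, intervalIntegral.integral_sub i2 i3,
        intervalIntegral.integral_sub i1 i2]
      ring
    simp only [Pi.sub_apply]
    rw [h1]
    refine (abs_add_le _ _).trans (add_le_add ?_
      (abs_integral_mul_le hy.1 hM (hu.continuous.sub hv.continuous)))
    refine (abs_integral_mul_le hy.1 hδ hv.continuous).trans ?_
    gcongr
    have h2 : ∀ t ∈ Set.Icc 0 y, |v t| ≤ (|v 0| + |deriv v 0|) * Real.exp ((1 + M) * x) := by
      intro t ht
      have := hv.abs_le hM' ht.1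
      have h3 : Real.exp ((1 + M) * t) ≤ Real.exp ((1 + M) * x) :=
        Real.exp_le_exp.2 (by gcongr; linarith [ht.2, hy.2])
      have h4 := mul_le_mul_of_nonneg_left h3 (by positivity : 0 ≤ |v 0| + |deriv v 0|)
      linarith [abs_nonneg (deriv v t)]
    have h5 := intervalIntegral.integral_mono_on (μ := volume) hy.1
      (hv.continuous.abs.intervalIntegrable _ _)
      (continuous_const.intervalIntegrable _ _) h2
    rw [intervalIntegral.integral_const, smul_eq_mul, sub_zero] at h5
    refine h5.trans ?_
    rw [mul_assoc]
    gcongr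
    exact hy.2

end Solutions

/-! ### Global existence by a weighted Picard iteration -/

section Existence

open BoundedContinuousFunction

theorem abs_integral_exp_abs_le {K : ℝ} (hK : 0 < K) (x : ℝ) :
    |∫ s in (0 : ℝ)..x, Real.exp (K * |s|)| ≤ Real.exp (K * |x|) / K := by
  have pos : ∀ y : ℝ, 0 ≤ y →
      |∫ s in (0 : ℝ)..y, Real.exp (K * |s|)| ≤ Real.exp (K * |y|) / K := by
    intro y hy
    have h1 : ∫ s in (0 : ℝ)..y, Real.exp (K * |s|) = ∫ s in (0 : ℝ)..y, Real.exp (K * s) := by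
      refine intervalIntegral.integral_congr fun s hs => ?_
      rw [Set.uIcc_of_le hy] at hs
      simp only [abs_of_nonneg hs.1]
    rw [h1, intervalIntegral.integral_comp_mul_left (fun s => Real.exp s) hK.ne', integral_exp,
      abs_of_nonneg hy, mul_zero, Real.exp_zero, smul_eq_mul, abs_of_nonneg]
    · rw [inv_mul_eq_div]; gcongr; linarith
    · have : 1 ≤ Real.exp (K * y) := Real.one_le_exp (by positivity)
      have : 0 ≤ Real.exp (K * y) - 1 := by linarith
      positivity
  rcases le_total 0 x with hx | hx
  · exact pos x hx
  · have h := pos (-x) (by linarith)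
    have h2 := intervalIntegral.integral_comp_neg (a := 0) (b := x)
      (fun s => Real.exp (K * |s|))
    simp only [abs_neg, neg_zero] at h2 h
    rw [h2, intervalIntegral.integral_symm, abs_neg]
    exact h

/-- The right-hand side of the weighted first-order system `(p, u)' = (g u, p)`. -/
noncomputable def weightedField (g : ℝ → ℝ) (K : ℝ) (f : ℝ → ℝ × ℝ) (s : ℝ) : ℝ × ℝ :=
  Real.exp (K * |s|) • (g s * (f s).2, (f s).1)

variable {g : ℝ → ℝ} {M K : ℝ}

theorem norm_weightedField_le (hM : ∀ t, |g t| ≤ M) (f : ℝ →ᵇ ℝ × ℝ) (s : ℝ) :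
    ‖weightedField g K f s‖ ≤ (1 + M) * ‖f‖ * Real.exp (K * |s|) := by
  have hM0 : 0 ≤ M := (abs_nonneg _).trans (hM 0)
  have h1 : ‖(f s).1‖ ≤ ‖f‖ := (norm_fst_le _).trans (f.norm_coe_le_norm s)
  have h2 : ‖(f s).2‖ ≤ ‖f‖ := (norm_snd_le _).trans (f.norm_coe_le_norm s)
  have hf := norm_nonneg f
  rw [weightedField, norm_smul, Real.norm_of_nonneg (Real.exp_pos _).le, mul_comm]
  gcongr
  rw [Prod.norm_def, max_le_iff]
  constructor
  · simp only [norm_mul]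
    calc ‖g s‖ * ‖(f s).2‖ ≤ M * ‖f‖ := by gcongr; exact hM s
      _ ≤ _ := by linarith
  · nlinarith

theorem intervalIntegrable_weightedField (hg : Measurable g) (hM : ∀ t, |g t| ≤ M)
    (f : ℝ →ᵇ ℝ × ℝ) (a b : ℝ) : IntervalIntegrable (weightedField g K f) volume a b := by
  have hc : Continuous fun s : ℝ => (1 + M) * ‖f‖ * Real.exp (K * |s|) := by fun_prop
  refine IntervalIntegrable.mono_fun' (hc.intervalIntegrable a b) ?_
    (ae_of_all _ fun s => norm_weightedField_le hM f s)
  have hf := f.continuous.measurable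
  have : Measurable (weightedField g K f) := by
    unfold weightedField
    exact (by fun_prop : Measurable fun s : ℝ => Real.exp (K * |s|)).smul
      ((hg.mul hf.snd).prodMk hf.fst)
  exact this.aestronglyMeasurable

theorem norm_integral_weightedField_le (hK : 0 < K) (hM : ∀ t, |g t| ≤ M)
    (f : ℝ →ᵇ ℝ × ℝ) (x : ℝ) :
    ‖Real.exp (-(K * |x|)) • ∫ s in (0 : ℝ)..x, weightedField g K f s‖ ≤ (1 + M) / K * ‖f‖ := by
  have hM0 : 0 ≤ M := (abs_nonneg _).trans (hM 0)
  have hc : Continuous fun s : ℝ => (1 + M) * ‖f‖ * Real.exp (K * |s|) := by fun_prop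
  have h1 : ‖∫ s in (0 : ℝ)..x, weightedField g K f s‖ ≤
      |∫ s in (0 : ℝ)..x, (1 + M) * ‖f‖ * Real.exp (K * |s|)| :=
    intervalIntegral.norm_integral_le_abs_of_norm_le
      (ae_of_all _ fun s => norm_weightedField_le hM f s) (hc.intervalIntegrable _ _)
  rw [intervalIntegral.integral_const_mul, abs_mul,
    abs_of_nonneg (by positivity : 0 ≤ (1 + M) * ‖f‖)] at h1
  rw [norm_smul, Real.norm_of_nonneg (Real.exp_pos _).le]
  calc _ ≤ Real.exp (-(K * |x|)) * ((1 + M) * ‖f‖ * (Real.exp (K * |x|) / K)) := by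
        gcongr
        exact h1.trans (by gcongr; exact abs_integral_exp_abs_le hK x)
    _ = (1 + M) / K * ‖f‖ * (Real.exp (-(K * |x|)) * Real.exp (K * |x|)) := by ring
    _ = _ := by rw [← Real.exp_add]; simp

/-- The weighted Picard operator on bounded continuous functions. -/
noncomputable def picardOperator (hg : Measurable g) (hM : ∀ t, |g t| ≤ M) (hK : 0 < K)
    (v : ℝ × ℝ) (f : ℝ →ᵇ ℝ × ℝ) : ℝ →ᵇ ℝ × ℝ :=
  BoundedContinuousFunction.ofNormedAddCommGroup
    (fun x => Real.exp (-(K * |x|)) • (v + ∫ s in (0 : ℝ)..x, weightedField g K f s))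
    ((by fun_prop : Continuous fun x : ℝ => Real.exp (-(K * |x|))).smul
      (continuous_const.add (intervalIntegral.continuous_primitive
        (fun a b => intervalIntegrable_weightedField hg hM f a b) 0)))
    (‖v‖ + (1 + M) / K * ‖f‖) (fun x => by
      rw [smul_add]
      refine (norm_add_le _ _).trans (add_le_add ?_ (norm_integral_weightedField_le hK hM f x))
      rw [norm_smul, Real.norm_of_nonneg (Real.exp_pos _).le]
      refine mul_le_of_le_one_left (norm_nonneg _) (Real.exp_le_one_iff.2 ?_)
      have := mul_nonneg hK.le (abs_nonneg x)
      linarith)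

/-- Writing `Y x = e^{K|x|} f x` with `f` bounded makes the integral operator a contraction on the
whole line at once, so no local solutions have to be glued. -/
theorem exists_integral_system (hg : Measurable g) (hM : ∀ t, |g t| ≤ M) (v : ℝ × ℝ) :
    ∃ Y : ℝ → ℝ × ℝ, Continuous Y ∧
      ∀ x, Y x = v + ∫ s in (0 : ℝ)..x, (g s * (Y s).2, (Y s).1) := by
  have hM0 : 0 ≤ M := (abs_nonneg _).trans (hM 0)
  -- The contraction factor is `(1 + M) / K`, which this choice makes `1 / 2`.
  set K := 2 * (1 + M)
  have hK : 0 < K := by positivity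
  have hc : ContractingWith (1 / 2) (picardOperator hg hM hK v) := by
    refine ⟨by norm_num, LipschitzWith.of_dist_le_mul fun f₁ f₂ => ?_⟩
    rw [BoundedContinuousFunction.dist_le (by positivity)]
    intro x
    have e : picardOperator hg hM hK v f₁ x - picardOperator hg hM hK v f₂ x =
        Real.exp (-(K * |x|)) • ∫ s in (0 : ℝ)..x, weightedField g K (f₁ - f₂ : ℝ →ᵇ ℝ × ℝ) s := by
      have : weightedField g K (f₁ - f₂ : ℝ →ᵇ ℝ × ℝ) =
          fun s => weightedField g K f₁ s - weightedField g K f₂ s := by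
        ext s <;> simp [weightedField] <;> ring
      rw [this, intervalIntegral.integral_sub (intervalIntegrable_weightedField hg hM f₁ 0 x)
        (intervalIntegrable_weightedField hg hM f₂ 0 x)]
      simp only [picardOperator, BoundedContinuousFunction.coe_ofNormedAddCommGroup]
      rw [← smul_sub]; congr 1; abel
    rw [dist_eq_norm, e, dist_eq_norm]
    refine (norm_integral_weightedField_le hK hM _ x).trans (le_of_eq ?_)
    congr 1
    simp only [K]
    push_cast
    field_simp
  set f := hc.fixedPoint
  have hf : picardOperator hg hM hK v f = f := hc.fixedPoint_isFixedPt
  refine ⟨fun x => Real.exp (K * |x|) • f x,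
    (by fun_prop : Continuous fun x : ℝ => Real.exp (K * |x|)).smul f.continuous, fun x => ?_⟩
  have h1 : (fun s => (g s * (Real.exp (K * |s|) • f s).2, (Real.exp (K * |s|) • f s).1)) =
      weightedField g K f := by
    ext s <;> simp [weightedField]; ring
  rw [h1]
  nth_rewrite 1 [← hf]
  simp only [picardOperator, BoundedContinuousFunction.coe_ofNormedAddCommGroup]
  rw [smul_smul, ← Real.exp_add]
  simp

theorem exists_isSolution {W : ℝ → ℝ} {E : ℝ} (hW : Measurable W) (hM : ∀ t, |W t - E| ≤ M)
    (b a : ℝ) : ∃ u : ℝ → ℝ, IsSolution W E u ∧ deriv u 0 = b ∧ u 0 = a := by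
  obtain ⟨Y, hYc, hY⟩ := exists_integral_system (hW.sub_const E) hM (b, a)
  have hi : ∀ x, IntervalIntegrable (fun s => ((W s - E) * (Y s).2, (Y s).1)) volume 0 x := by
    intro x
    have h1 := intervalIntegrable_mul_of_bounded hW hM hYc.snd 0 x
    have h2 := hYc.fst.intervalIntegrable (μ := volume) 0 x
    rw [intervalIntegrable_iff] at h1 h2 ⊢
    exact h1.prodMk h2
  have hp : ∀ x, (Y x).1 = b + ∫ s in (0 : ℝ)..x, (W s - E) * (Y s).2 := by
    intro x
    rw [hY x]
    exact congrArg (b + ·)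
      ((ContinuousLinearMap.fst ℝ ℝ ℝ).intervalIntegral_comp_comm (hi x)).symm
  have hu : ∀ x, (Y x).2 = a + ∫ s in (0 : ℝ)..x, (Y s).1 := by
    intro x
    rw [hY x]
    exact congrArg (a + ·)
      ((ContinuousLinearMap.snd ℝ ℝ ℝ).intervalIntegral_comp_comm (hi x)).symm
  have hd : ∀ x, HasDerivAt (fun x => (Y x).2) (Y x).1 x := by
    intro x
    rw [funext hu]
    exact (intervalIntegral.integral_hasDerivAt_right (hYc.fst.intervalIntegrable _ _)
      (hYc.fst.stronglyMeasurableAtFilter _ _) hYc.fst.continuousAt).const_add _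
  have hp0 : (Y 0).1 = b := by rw [hp 0]; simp
  refine ⟨fun x => (Y x).2, isSolution_of_integral hW hM (p := fun x => (Y x).1) hd
    (fun x => ?_), ?_, ?_⟩
  · rw [hp0]; exact hp x
  · rw [(hd 0).deriv, hp0]
  · simp only [hu 0]; simp

end Existence

/-! ### Norms of real two-by-two matrices -/

section MatrixNorm

theorem exists_l2_opNorm_le_of_entries :
    ∃ C : ℝ, 0 ≤ C ∧ ∀ (A : Matrix (Fin 2) (Fin 2) ℝ) (r : ℝ), (∀ i j, |A i j| ≤ r) →
      ‖A‖ ≤ C * r := by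
  refine ⟨∑ i : Fin 2, ∑ j : Fin 2, ‖Matrix.single i j (1 : ℝ)‖, by positivity,
    fun A r h => ?_⟩
  conv_lhs => rw [Matrix.matrix_eq_sum_single A]
  rw [Finset.sum_mul]
  refine (norm_sum_le _ _).trans (Finset.sum_le_sum fun i _ => ?_)
  rw [Finset.sum_mul]
  refine (norm_sum_le _ _).trans (Finset.sum_le_sum fun j _ => ?_)
  have : Matrix.single i j (A i j) = A i j • Matrix.single i j (1 : ℝ) := by
    rw [Matrix.smul_single, smul_eq_mul, mul_one]
  rw [this, norm_smul, mul_comm, Real.norm_eq_abs]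
  gcongr
  exact h i j

/-- In dimension two the adjugate is the transpose conjugated by the rotation by a right angle. For
determinant one this controls the inverse by the matrix itself. -/
theorem l2_opNorm_adjugate_le (A : Matrix (Fin 2) (Fin 2) ℝ) : ‖A.adjugate‖ ≤ ‖A‖ := by
  set J : Matrix (Fin 2) (Fin 2) ℝ := !![0, 1; -1, 0]
  have hJ : J ∈ unitary (Matrix (Fin 2) (Fin 2) ℝ) := by
    rw [Unitary.mem_iff]
    constructor <;> ext i j <;> fin_cases i <;> fin_cases j <;>
      simp [J, Matrix.star_eq_conjTranspose, Matrix.mul_apply, Fin.sum_univ_two]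
  have e : A.adjugate = J * A.conjTranspose * star J := by
    ext i j
    fin_cases i <;> fin_cases j <;>
      simp [J, Matrix.star_eq_conjTranspose, Matrix.mul_apply, Fin.sum_univ_two,
        Matrix.adjugate_fin_two, Matrix.vecMul, dotProduct]
  have h1 : ‖J‖ = 1 := CStarRing.norm_of_mem_unitary hJ
  have h2 : ‖star J‖ = 1 := CStarRing.norm_of_mem_unitary (Unitary.star_mem hJ)
  rw [e]
  refine (norm_mul_le _ _).trans ?_
  rw [h2, mul_one]
  refine (norm_mul_le _ _).trans ?_
  rw [h1, one_mul, Matrix.l2_opNorm_conjTranspose]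

theorem one_le_l2_opNorm_of_det_eq_one {A : Matrix (Fin 2) (Fin 2) ℝ} (hA : A.det = 1) :
    1 ≤ ‖A‖ := by
  have h1 : A * A.adjugate = 1 := by rw [Matrix.mul_adjugate, hA, one_smul]
  have h2 := norm_mul_le A A.adjugate
  rw [h1, norm_one] at h2
  nlinarith [l2_opNorm_adjugate_le A, norm_nonneg A]

end MatrixNorm

/-! ### Transfer matrices -/

section Transfer

variable {W : ℝ → ℝ} {E M : ℝ}

theorem IsSolution.comp_add_right {u : ℝ → ℝ} (hW : Measurable W) (hM : ∀ t, |W t - E| ≤ M)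
    (hu : IsSolution W E u) (c : ℝ) :
    IsSolution (fun t => W (t + c)) E (fun t => u (t + c)) := by
  refine isSolution_of_integral (hW.comp (measurable_add_const c)) (fun t => hM (t + c))
    (p := fun x => deriv u (x + c))
    (fun x => (hu.differentiable (x + c)).hasDerivAt.comp_add_const x c) fun x => ?_
  rw [zero_add, intervalIntegral.integral_comp_add_right (fun t => (W t - E) * u t) c, zero_add]
  exact hu.deriv_eq c (x + c)

theorem IsSolution.eq_zero_of_nonneg {u : ℝ → ℝ} (hM : ∀ t, |W t - E| ≤ M)
    (hu : IsSolution W E u) (h0 : u 0 = 0) (h0' : deriv u 0 = 0) {x : ℝ} (hx : 0 ≤ x) :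
    u x = 0 ∧ deriv u x = 0 := by
  have h := hu.abs_le hM hx
  rw [h0, h0', abs_zero, add_zero, zero_mul] at h
  exact ⟨abs_eq_zero.1 (by linarith [abs_nonneg (u x), abs_nonneg (deriv u x)]),
    abs_eq_zero.1 (by linarith [abs_nonneg (u x), abs_nonneg (deriv u x)])⟩

theorem exists_isTransferMatrix (hW : Measurable W) (hM : ∀ t, |W t - E| ≤ M) {x : ℝ}
    (hx : 0 ≤ x) : ∃ T, IsTransferMatrix W E 0 x T := by
  obtain ⟨u₁, h₁, d₁, i₁⟩ := exists_isSolution hW hM 1 0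
  obtain ⟨u₂, h₂, d₂, i₂⟩ := exists_isSolution hW hM 0 1
  refine ⟨!![deriv u₁ x, deriv u₂ x; u₁ x, u₂ x], fun u hu => ?_⟩
  have hw := (h₁.linear_combination hW hM h₂ (deriv u 0) (u 0))
  -- The difference of `u` and the combination of basis solutions with the same initial data has
  -- zero data, hence vanishes.
  have hz := hu.linear_combination hW hM hw 1 (-1)
  have hd : ∀ y, deriv (fun x => 1 * u x + -1 * (deriv u 0 * u₁ x + u 0 * u₂ x)) y =
      1 * deriv u y + -1 * (deriv u 0 * deriv u₁ y + u 0 * deriv u₂ y) := fun y =>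
    (((hu.differentiable y).hasDerivAt.const_mul 1).add
      ((((h₁.differentiable y).hasDerivAt.const_mul _).add
        ((h₂.differentiable y).hasDerivAt.const_mul _)).const_mul (-1))).deriv
  have := hz.eq_zero_of_nonneg hM (by simp [i₁, i₂]) (by rw [hd]; simp [d₁, d₂]) hx
  rw [hd] at this
  ext i
  fin_cases i <;> simp [Matrix.mulVec, dotProduct, Fin.sum_univ_two] <;> linarith [this.1, this.2]

theorem isTransferMatrix_transferMatrix (hW : Measurable W) (hM : ∀ t, |W t - E| ≤ M) {x : ℝ}
    (hx : 0 ≤ x) : IsTransferMatrix W E 0 x (transferMatrix W E 0 x) :=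
  Classical.epsilon_spec (exists_isTransferMatrix hW hM hx)

/-- The two normalized solutions determine the columns. This uniqueness is what makes the matrix
picked by `Classical.epsilon` computable. -/
theorem IsTransferMatrix.entries {x : ℝ} {T : Matrix (Fin 2) (Fin 2) ℝ}
    (hT : IsTransferMatrix W E 0 x T) {u₁ u₂ : ℝ → ℝ} (h₁ : IsSolution W E u₁)
    (h₂ : IsSolution W E u₂) (d₁ : deriv u₁ 0 = 1) (i₁ : u₁ 0 = 0) (d₂ : deriv u₂ 0 = 0)
    (i₂ : u₂ 0 = 1) : T = !![deriv u₁ x, deriv u₂ x; u₁ x, u₂ x] := by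
  have e₁ := hT u₁ h₁
  have e₂ := hT u₂ h₂
  rw [d₁, i₁] at e₁
  rw [d₂, i₂] at e₂
  ext i j
  have e₁' := congrFun e₁ i
  have e₂' := congrFun e₂ i
  fin_cases i <;> fin_cases j <;>
    first
    | simpa [Matrix.mulVec, dotProduct, Fin.sum_univ_two] using e₁'
    | simpa [Matrix.mulVec, dotProduct, Fin.sum_univ_two] using e₂'

theorem IsTransferMatrix.eq_transferMatrix (hW : Measurable W) (hM : ∀ t, |W t - E| ≤ M) {x : ℝ}
    (hx : 0 ≤ x) {T : Matrix (Fin 2) (Fin 2) ℝ} (hT : IsTransferMatrix W E 0 x T) :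
    T = transferMatrix W E 0 x := by
  obtain ⟨u₁, h₁, d₁, i₁⟩ := exists_isSolution hW hM 1 0
  obtain ⟨u₂, h₂, d₂, i₂⟩ := exists_isSolution hW hM 0 1
  rw [hT.entries h₁ h₂ d₁ i₁ d₂ i₂,
    (isTransferMatrix_transferMatrix hW hM hx).entries h₁ h₂ d₁ i₁ d₂ i₂]

theorem transferMatrix_add (hW : Measurable W) (hM : ∀ t, |W t - E| ≤ M) {c x : ℝ}
    (hc : 0 ≤ c) (hx : 0 ≤ x) :
    transferMatrix W E 0 (c + x) =
      transferMatrix (fun t => W (t + c)) E 0 x * transferMatrix W E 0 c := by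
  symm
  refine IsTransferMatrix.eq_transferMatrix hW hM (by positivity) fun u hu => ?_
  rw [← Matrix.mulVec_mulVec, isTransferMatrix_transferMatrix hW hM hc u hu]
  have := isTransferMatrix_transferMatrix (hW.comp (measurable_add_const c))
    (fun t => hM (t + c)) hx _ (hu.comp_add_right hW hM c)
  have hd : ∀ y, deriv (fun t => u (t + c)) y = deriv u (y + c) := fun y =>
    deriv_comp_add_const u c y
  rw [hd, hd, zero_add] at this
  rw [add_comm c x]
  exact this

/-- The derivative vanishes only almost everywhere, so constancy rests on absolute continuity. -/
theorem wronskian_eq {u v : ℝ → ℝ} (hu : IsSolution W E u) (hv : IsSolution W E v) (x : ℝ) :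
    deriv u x * v x - deriv v x * u x = deriv u 0 * v 0 - deriv v 0 * u 0 := by
  have ac : ∀ {w : ℝ → ℝ}, IsSolution W E w → AbsolutelyContinuousOnInterval w 0 x := fun hw =>
    (contDiff_one_iff_deriv.2
      ⟨hw.differentiable, hw.continuous_deriv⟩).contDiffOn.absolutelyContinuousOnInterval
  have hac : AbsolutelyContinuousOnInterval
      (fun x => deriv u x * v x - deriv v x * u x) 0 x :=
    ((hu.deriv_ac 0 x).mul (ac hv)).sub ((hv.deriv_ac 0 x).mul (ac hu))
  obtain ⟨c, hc⟩ := hac.const_of_ae_hasDerivAt_zero (by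
    filter_upwards [(hu.deriv_ac 0 x).ae_differentiableAt, (hv.deriv_ac 0 x).ae_differentiableAt,
      hu.equation, hv.equation] with t h₁ h₂ e₁ e₂ ht
    have := ((h₁ ht).hasDerivAt.mul (hv.differentiable t).hasDerivAt).sub
      ((h₂ ht).hasDerivAt.mul (hu.differentiable t).hasDerivAt)
    simp only [RCLike.ofReal_real_eq_id, id] at e₁ e₂
    have e₁' : deriv (deriv u) t = (W t - E) * u t := by linarith
    have e₂' : deriv (deriv v) t = (W t - E) * v t := by linarith
    rw [e₁', e₂'] at this
    exact this.congr_deriv (by ring))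
  rw [hc x Set.right_mem_uIcc, hc 0 Set.left_mem_uIcc]

theorem det_transferMatrix (hW : Measurable W) (hM : ∀ t, |W t - E| ≤ M) {x : ℝ}
    (hx : 0 ≤ x) : (transferMatrix W E 0 x).det = 1 := by
  obtain ⟨u₁, h₁, d₁, i₁⟩ := exists_isSolution hW hM 1 0
  obtain ⟨u₂, h₂, d₂, i₂⟩ := exists_isSolution hW hM 0 1
  rw [(isTransferMatrix_transferMatrix hW hM hx).entries h₁ h₂ d₁ i₁ d₂ i₂,
    Matrix.det_fin_two_of, wronskian_eq h₁ h₂, d₁, i₁, d₂, i₂]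
  norm_num

theorem exists_norm_transferMatrix_le (E M x : ℝ) :
    ∃ C, 0 < C ∧ ∀ W : ℝ → ℝ, Measurable W → (∀ t, |W t - E| ≤ M) → ∀ y ∈ Set.Icc 0 x,
      ‖transferMatrix W E 0 y‖ ≤ C := by
  obtain ⟨C, hC0, hC⟩ := exists_l2_opNorm_le_of_entries
  refine ⟨C * Real.exp ((1 + M) * x) + 1, by positivity, fun W hW hM y hy => ?_⟩
  have hM0 : 0 ≤ M := (abs_nonneg _).trans (hM 0)
  obtain ⟨u₁, h₁, d₁, i₁⟩ := exists_isSolution hW hM 1 0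
  obtain ⟨u₂, h₂, d₂, i₂⟩ := exists_isSolution hW hM 0 1
  have b₁ := h₁.abs_le hM hy.1
  have b₂ := h₂.abs_le hM hy.1
  rw [d₁, i₁, abs_zero, abs_one, zero_add, one_mul] at b₁
  rw [d₂, i₂, abs_zero, abs_one, add_zero, one_mul] at b₂
  have hexp : Real.exp ((1 + M) * y) ≤ Real.exp ((1 + M) * x) :=
    Real.exp_le_exp.2 (by gcongr; exact hy.2)
  refine (hC _ (Real.exp ((1 + M) * x)) ?_).trans (by linarith)
  rw [(isTransferMatrix_transferMatrix hW hM hy.1).entries h₁ h₂ d₁ i₁ d₂ i₂]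
  have n₁ := abs_nonneg (u₁ y)
  have n₂ := abs_nonneg (u₂ y)
  have n₃ := abs_nonneg (deriv u₁ y)
  have n₄ := abs_nonneg (deriv u₂ y)
  intro i j
  fin_cases i <;> fin_cases j <;> simp <;> linarith

theorem exists_norm_transferMatrix_sub_le (E M x : ℝ) (hx : 0 ≤ x) :
    ∃ C, 0 < C ∧ ∀ (W W' : ℝ → ℝ) (δ : ℝ), Measurable W → Measurable W' →
      (∀ t, |W t - E| ≤ M) → (∀ t, |W' t - E| ≤ M) → (∀ t, |W t - W' t| ≤ δ) →
      ‖transferMatrix W E 0 x - transferMatrix W' E 0 x‖ ≤ C * δ := by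
  obtain ⟨C, hC0, hC⟩ := exists_l2_opNorm_le_of_entries
  set D := x * Real.exp ((1 + M) * x) * Real.exp ((1 + M) * x)
  have hD : 0 ≤ D := by positivity
  refine ⟨C * D + 1, by positivity, fun W W' δ hW hW' hM hM' hδ => ?_⟩
  have hδ0 : 0 ≤ δ := (abs_nonneg _).trans (hδ 0)
  obtain ⟨u₁, h₁, d₁, i₁⟩ := exists_isSolution hW hM 1 0
  obtain ⟨u₂, h₂, d₂, i₂⟩ := exists_isSolution hW hM 0 1
  obtain ⟨v₁, h₁', d₁', i₁'⟩ := exists_isSolution hW' hM' 1 0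
  obtain ⟨v₂, h₂', d₂', i₂'⟩ := exists_isSolution hW' hM' 0 1
  have b₁ := h₁.abs_sub_le hW hW' hM hM' hδ h₁' (by rw [i₁, i₁']) (by rw [d₁, d₁']) hx
  have b₂ := h₂.abs_sub_le hW hW' hM hM' hδ h₂' (by rw [i₂, i₂']) (by rw [d₂, d₂']) hx
  rw [d₁', i₁', abs_zero, abs_one, zero_add, mul_one] at b₁
  rw [d₂', i₂', abs_zero, abs_one, add_zero, mul_one] at b₂
  refine (hC _ (δ * D) ?_).trans (by nlinarith)
  rw [(isTransferMatrix_transferMatrix hW hM hx).entries h₁ h₂ d₁ i₁ d₂ i₂,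
    (isTransferMatrix_transferMatrix hW' hM' hx).entries h₁' h₂' d₁' i₁' d₂' i₂']
  have n₁ := abs_nonneg (u₁ x - v₁ x)
  have n₂ := abs_nonneg (u₂ x - v₂ x)
  have n₃ := abs_nonneg (deriv u₁ x - deriv v₁ x)
  have n₄ := abs_nonneg (deriv u₂ x - deriv v₂ x)
  intro i j
  fin_cases i <;> fin_cases j <;> simp <;> linarith

end Transfer

/-! ### From piecewise Hölder to Hölder on the circle -/

section Holder

theorem abs_sub_le_of_piecewise_holder_of_le {γ C : ℝ} (hγ : 0 < γ) (hC : 0 ≤ C) {n : ℕ}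
    {a : Fin (n + 1) → ℝ} (ha : StrictMono a) {f : ℝ → ℝ}
    (hf : ∀ i : Fin n, ∀ y ∈ Set.Icc (a i.castSucc) (a i.succ),
      ∀ z ∈ Set.Icc (a i.castSucc) (a i.succ), |f y - f z| ≤ C * |y - z| ^ γ)
    {y z : ℝ} (hz : a 0 ≤ z) (hzy : z ≤ y) (hy : y ≤ a (Fin.last n)) :
    |f y - f z| ≤ n * C * |y - z| ^ γ := by
  -- Clamping the partition to `[z, y]` gives a chain from `z` to `y` whose steps each stay in one
  -- piece or are trivial; telescoping costs the factor `n`.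
  set e : Fin (n + 1) → ℝ := fun i => max z (min (a i) y) with he
  have step : ∀ i : Fin n, |f (e i.succ) - f (e i.castSucc)| ≤ C * |y - z| ^ γ := by
    intro i
    have hlt : a i.castSucc < a i.succ := ha Fin.castSucc_lt_succ
    have hnn : 0 ≤ C * |y - z| ^ γ := by positivity
    rcases le_total (a i.succ) z with h | h
    · have h1 : e i.succ = z := by simp [he, h]
      have h2 : e i.castSucc = z := by simp [he, hlt.le.trans h]
      rw [h1, h2, sub_self, abs_zero]; exact hnn
    rcases le_total y (a i.castSucc) with h' | h'
    · have h1 : e i.succ = y := by simp [he, h'.trans hlt.le, hzy]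
      have h2 : e i.castSucc = y := by simp [he, h', hzy]
      rw [h1, h2, sub_self, abs_zero]; exact hnn
    have h1 : e i.succ = min (a i.succ) y := max_eq_right (le_min h hzy)
    have h2 : e i.castSucc = max z (a i.castSucc) := by simp only [he, min_eq_left h']
    have hle : e i.castSucc ≤ e i.succ := max_le_max_left _ (min_le_min_right _ hlt.le)
    have hzl : z ≤ e i.castSucc := le_max_left _ _
    have hyl : e i.succ ≤ y := by rw [h1]; exact min_le_right _ _
    have hal : a i.castSucc ≤ e i.castSucc := by rw [h2]; exact le_max_right _ _
    have har : e i.succ ≤ a i.succ := by rw [h1]; exact min_le_left _ _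
    refine (hf i _ ⟨hal.trans hle, har⟩ _ ⟨hal, hle.trans har⟩).trans ?_
    gcongr 1
    refine Real.rpow_le_rpow (abs_nonneg _) ?_ hγ.le
    rw [abs_of_nonneg (by linarith), abs_of_nonneg (by linarith)]
    linarith
  have key : ∀ k : Fin (n + 1), |f (e k) - f (e 0)| ≤ (k : ℕ) * C * |y - z| ^ γ := by
    intro k
    induction k using Fin.induction with
    | zero => simp
    | succ i ih =>
      have h1 := abs_sub_le (f (e i.succ)) (f (e i.castSucc)) (f (e 0))
      have h2 := step i
      simp only [Fin.val_castSucc, Fin.val_succ] at ih ⊢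
      push_cast
      linarith
  have h := key (Fin.last n)
  have h0 : e 0 = z := by simp [he, hz]
  have hl : e (Fin.last n) = y := by simp [he, hy, hzy]
  rwa [h0, hl, Fin.val_last] at h

theorem abs_sub_le_of_piecewise_holder {γ C : ℝ} (hγ : 0 < γ) (hC : 0 ≤ C) {n : ℕ}
    {a : Fin (n + 1) → ℝ} (ha : StrictMono a) {f : ℝ → ℝ}
    (hf : ∀ i : Fin n, ∀ y ∈ Set.Icc (a i.castSucc) (a i.succ),
      ∀ z ∈ Set.Icc (a i.castSucc) (a i.succ), |f y - f z| ≤ C * |y - z| ^ γ)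
    {y z : ℝ} (hy : y ∈ Set.Icc (a 0) (a (Fin.last n)))
    (hz : z ∈ Set.Icc (a 0) (a (Fin.last n))) :
    |f y - f z| ≤ n * C * |y - z| ^ γ := by
  rcases le_total z y with h | h
  · exact abs_sub_le_of_piecewise_holder_of_le hγ hC ha hf hz.1 h hy.2
  · rw [abs_sub_comm, abs_sub_comm y z]
    exact abs_sub_le_of_piecewise_holder_of_le hγ hC ha hf hy.1 h hz.2

/-- On the circle, a bound on the unit interval passes to the circle at the cost of a factor. -/
theorem abs_sub_le_of_holder_unitInterval {γ C : ℝ} (hγ : 0 < γ) (hC : 0 ≤ C)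
    {f : UnitAddCircle → ℝ}
    (hf : ∀ y ∈ Set.Icc (0 : ℝ) 1, ∀ z ∈ Set.Icc (0 : ℝ) 1,
      |f (y : UnitAddCircle) - f (z : UnitAddCircle)| ≤ C * |y - z| ^ γ)
    (y z : UnitAddCircle) : |f y - f z| ≤ 2 * C * ‖y - z‖ ^ γ := by
  have h01 : ((1 : ℝ) : UnitAddCircle) = ((0 : ℝ) : UnitAddCircle) := by
    rw [AddCircle.coe_period, AddCircle.coe_zero]
  -- When the short arc crosses the glued point `0 = 1`, the path is split there into `y` to `1` and
  -- `0` to `z`; this gives the factor `2`.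
  have aux : ∀ y ∈ Set.Ico (0 : ℝ) 1, ∀ z ∈ Set.Ico (0 : ℝ) 1,
      |f (y : UnitAddCircle) - f (z : UnitAddCircle)| ≤ 2 * C * |y - z - 1| ^ γ := by
    intro y hy z hz
    have h1 := hf y ⟨hy.1, hy.2.le⟩ 1 ⟨zero_le_one, le_rfl⟩
    have h2 := hf 0 ⟨le_rfl, zero_le_one⟩ z ⟨hz.1, hz.2.le⟩
    rw [h01] at h1
    have h3 : |y - 1| ^ γ ≤ |y - z - 1| ^ γ := by
      refine Real.rpow_le_rpow (abs_nonneg _) ?_ hγ.le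
      rw [abs_of_nonpos (by linarith [hy.2]), abs_of_nonpos (by linarith [hy.2, hz.1])]
      linarith [hz.1]
    have h4 : |0 - z| ^ γ ≤ |y - z - 1| ^ γ := by
      refine Real.rpow_le_rpow (abs_nonneg _) ?_ hγ.le
      rw [abs_of_nonpos (by linarith [hz.1]), abs_of_nonpos (by linarith [hy.2, hz.1])]
      linarith [hy.2]
    have h5 := abs_sub_le (f (y : UnitAddCircle)) (f ((0 : ℝ) : UnitAddCircle))
      (f (z : UnitAddCircle))
    nlinarith [mul_le_mul_of_nonneg_left h3 hC, mul_le_mul_of_nonneg_left h4 hC]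
  obtain ⟨y, hy, rfl⟩ := AddCircle.eq_coe_Ico y
  obtain ⟨z, hz, rfl⟩ := AddCircle.eq_coe_Ico z
  rw [← AddCircle.coe_sub, UnitAddCircle.norm_eq]
  have hr := abs_le.1 (abs_sub_round (y - z))
  have hr1 : round (y - z) < 2 := by
    have : (round (y - z) : ℝ) < 2 := by linarith [hy.1, hy.2, hz.1, hz.2]
    exact_mod_cast this
  have hr2 : -2 < round (y - z) := by
    have : (-2 : ℝ) < round (y - z) := by linarith [hy.1, hy.2, hz.1, hz.2]
    exact_mod_cast this
  have hr3 : round (y - z) = 0 ∨ round (y - z) = 1 ∨ round (y - z) = -1 := by omega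
  rcases hr3 with h | h | h
  · rw [h, Int.cast_zero, sub_zero]
    have h1 := hf y ⟨hy.1, hy.2.le⟩ z ⟨hz.1, hz.2.le⟩
    have : 0 ≤ C * |y - z| ^ γ := by positivity
    linarith
  · rw [h, Int.cast_one]
    exact aux y hy z hz
  · rw [h, abs_sub_comm, ← abs_neg (y - z - _)]
    have := aux z hz y hy
    convert this using 4
    push_cast
    ring

theorem PiecewiseHolder.exists_holder {γ : ℝ} (hγ : 0 < γ) {V : UnitAddCircle × UnitAddCircle → ℝ}
    (hV : PiecewiseHolder γ V) :
    ∃ C, 0 ≤ C ∧ (∀ p, |V p| ≤ C) ∧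
      ∀ x y z : UnitAddCircle, |V (x, y) - V (x, z)| ≤ C * ‖y - z‖ ^ γ := by
  obtain ⟨-, n, a, ha, ha0, ha1, C, hb, hh⟩ := hV
  have hC : 0 ≤ C := (abs_nonneg _).trans (hb 0)
  refine ⟨(2 * n + 1) * C, by positivity, fun p => (hb p).trans ?_, fun x y z => ?_⟩
  · have : (0 : ℝ) ≤ n * C := by positivity
    linarith
  · refine (abs_sub_le_of_holder_unitInterval hγ (C := n * C) (by positivity)
      (f := fun w => V (x, w)) (fun y hy z hz => ?_) y z).trans ?_
    · rw [← ha0, ← ha1] at hy hz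
      exact abs_sub_le_of_piecewise_holder hγ hC ha (f := fun r => V (x, (r : UnitAddCircle)))
        (hh x) hy hz
    · have : 0 ≤ C * ‖y - z‖ ^ γ := by positivity
      linarith

end Holder

/-! ### The cocycle of a quasi-periodic potential -/

/-- A Hölder continuous `SL(2, ℝ)`-cocycle `A` over the rotation by `α`; the matrix `A n θ` is the
`n`-step transfer matrix at the phase `θ`. -/
structure IsHolderCocycle (A : ℕ → UnitAddCircle → Matrix (Fin 2) (Fin 2) ℝ) (α : UnitAddCircle)
    (γ C : ℝ) : Prop where
  det_eq : ∀ n θ, (A n θ).det = 1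
  add : ∀ m n θ, A (m + n) θ = A n (θ + m • α) * A m θ
  norm_le : ∀ θ, ‖A 1 θ‖ ≤ C
  holder : ∀ θ θ', ‖A 1 θ - A 1 θ'‖ ≤ C * ‖θ - θ'‖ ^ γ

section QuasiPotential

variable {γ C ω E : ℝ} {V : UnitAddCircle × UnitAddCircle → ℝ}

theorem measurable_quasiPotential (hV : Measurable V) (ω : ℝ) (θ : UnitAddCircle) :
    Measurable (quasiPotential V ω θ) := by
  have hc : Continuous ((↑) : ℝ → UnitAddCircle) := AddCircle.continuous_mk' _
  have : Continuous fun t : ℝ =>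
      ((t : UnitAddCircle), θ + ((ω * t : ℝ) : UnitAddCircle)) :=
    hc.prodMk (continuous_const.add (hc.comp (continuous_const.mul continuous_id)))
  exact hV.comp this.measurable

theorem abs_quasiPotential_sub_energy_le (hC : ∀ p, |V p| ≤ C) (E ω : ℝ) (θ : UnitAddCircle)
    (t : ℝ) : |quasiPotential V ω θ t - E| ≤ C + |E| :=
  (abs_sub _ _).trans (add_le_add (hC _) le_rfl)

theorem abs_quasiPotential_sub_le
    (hh : ∀ x y z : UnitAddCircle, |V (x, y) - V (x, z)| ≤ C * ‖y - z‖ ^ γ)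
    (θ θ' : UnitAddCircle) (t : ℝ) :
    |quasiPotential V ω θ t - quasiPotential V ω θ' t| ≤ C * ‖θ - θ'‖ ^ γ := by
  have := hh t (θ + ((ω * t : ℝ) : UnitAddCircle)) (θ' + ((ω * t : ℝ) : UnitAddCircle))
  rwa [add_sub_add_right_eq_sub] at this

/-- Periodicity in the first variable turns integer time shifts into phase shifts, which is why
blocks of integer length are used throughout. -/
theorem quasiPotential_add_int (V : UnitAddCircle × UnitAddCircle → ℝ) (ω : ℝ)
    (θ : UnitAddCircle) (n : ℤ) (t : ℝ) :
    quasiPotential V ω θ (t + n) = quasiPotential V ω (θ + n • (ω : UnitAddCircle)) t := by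
  have h1 : ((t + n : ℝ) : UnitAddCircle) = t := by
    rw [AddCircle.coe_add]
    have : ((n : ℝ) : UnitAddCircle) = 0 :=
      (AddCircle.coe_eq_zero_iff (1 : ℝ)).2 ⟨n, by simp⟩
    rw [this, add_zero]
  have h2 : ((ω * (t + n) : ℝ) : UnitAddCircle) =
      n • (ω : UnitAddCircle) + ((ω * t : ℝ) : UnitAddCircle) := by
    rw [← AddCircle.coe_zsmul, ← AddCircle.coe_add]
    congr 1
    simp only [zsmul_eq_mul]
    ring
  simp only [quasiPotential, h1, h2, add_assoc]

theorem transferMatrix_quasiPotential_add (hV : Measurable V) (hC : ∀ p, |V p| ≤ C)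
    (θ : UnitAddCircle) (n : ℕ) {x : ℝ} (hx : 0 ≤ x) :
    transferMatrix (quasiPotential V ω θ) E 0 (n + x) =
      transferMatrix (quasiPotential V ω (θ + n • (ω : UnitAddCircle))) E 0 x *
        transferMatrix (quasiPotential V ω θ) E 0 n := by
  rw [transferMatrix_add (measurable_quasiPotential hV ω θ)
    (abs_quasiPotential_sub_energy_le hC E ω θ) (Nat.cast_nonneg n) hx]
  congr 2
  ext t
  have := quasiPotential_add_int V ω θ n t
  simpa using this

theorem exists_isHolderCocycle (hV : Measurable V) (hC : ∀ p, |V p| ≤ C)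
    (hh : ∀ x y z : UnitAddCircle, |V (x, y) - V (x, z)| ≤ C * ‖y - z‖ ^ γ) (ω E : ℝ) :
    ∃ D, IsHolderCocycle (fun n θ => transferMatrix (quasiPotential V ω θ) E 0 n)
      (ω : UnitAddCircle) γ D := by
  have hC0 : 0 ≤ C := (abs_nonneg _).trans (hC 0)
  obtain ⟨C₁, h₁, b₁⟩ := exists_norm_transferMatrix_le E (C + |E|) 1
  obtain ⟨C₂, h₂, b₂⟩ := exists_norm_transferMatrix_sub_le E (C + |E|) 1 zero_le_one
  have hm := measurable_quasiPotential hV ω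
  have hM := abs_quasiPotential_sub_energy_le hC E ω
  refine ⟨C₁ + C₂ * C, fun n θ => det_transferMatrix (hm θ) (hM θ) n.cast_nonneg,
    fun m n θ => ?_, fun θ => ?_, fun θ θ' => ?_⟩
  · simp only [Nat.cast_add]
    exact transferMatrix_quasiPotential_add hV hC θ m n.cast_nonneg
  · have := b₁ _ (hm θ) (hM θ) 1 ⟨zero_le_one, le_rfl⟩
    have h3 : 0 ≤ C₂ * C := by positivity
    rw [Nat.cast_one]
    linarith
  · have := b₂ _ _ _ (hm θ) (hm θ') (hM θ) (hM θ') (abs_quasiPotential_sub_le hh θ θ')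
    have h3 : 0 ≤ C₁ * ‖θ - θ'‖ ^ γ := by positivity
    rw [Nat.cast_one]
    linarith

theorem continuous_transferMatrix_quasiPotential (hγ : 0 < γ) (hV : Measurable V)
    (hC : ∀ p, |V p| ≤ C)
    (hh : ∀ x y z : UnitAddCircle, |V (x, y) - V (x, z)| ≤ C * ‖y - z‖ ^ γ) {x : ℝ}
    (hx : 0 ≤ x) :
    Continuous fun θ => transferMatrix (quasiPotential V ω θ) E 0 x := by
  obtain ⟨C₂, h₂, b₂⟩ := exists_norm_transferMatrix_sub_le E (C + |E|) x hx
  refine continuous_iff_continuousAt.2 fun θ₀ => ?_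
  rw [ContinuousAt, tendsto_iff_norm_sub_tendsto_zero]
  have hlim : Tendsto (fun θ : UnitAddCircle => C₂ * (C * ‖θ - θ₀‖ ^ γ)) (𝓝 θ₀) (𝓝 0) := by
    have : Continuous fun θ : UnitAddCircle => C₂ * (C * ‖θ - θ₀‖ ^ γ) :=
      continuous_const.mul (continuous_const.mul
        ((continuous_id.sub continuous_const).norm.rpow_const fun _ => Or.inr hγ.le))
    have h := this.tendsto θ₀
    simpa [Real.zero_rpow hγ.ne'] using h
  exact squeeze_zero (fun _ => norm_nonneg _) (fun θ => b₂ _ _ _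
    (measurable_quasiPotential hV ω θ) (measurable_quasiPotential hV ω θ₀)
    (abs_quasiPotential_sub_energy_le hC E ω θ) (abs_quasiPotential_sub_energy_le hC E ω θ₀)
    (abs_quasiPotential_sub_le hh θ θ₀)) hlim

end QuasiPotential

/-! ### Uniform equidistribution for irrational rotations -/

section Equidistribution

/-- The averages of `f` along the rotation by `α` converge uniformly to the mean of `f`. -/
def UniformlyEquidistributed (α : UnitAddCircle) (f : C(UnitAddCircle, ℂ)) : Prop :=
  ∀ ε > 0, ∀ᶠ N : ℕ in atTop, ∀ θ : UnitAddCircle,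
    ‖∑ j ∈ Finset.range N, f (θ + j • α) - N * ∫ x, f x‖ ≤ ε * N

variable {α : UnitAddCircle}

theorem integrable_continuousMap_addCircle (f : C(UnitAddCircle, ℂ)) : Integrable f volume :=
  f.continuous.integrable_of_hasCompactSupport (HasCompactSupport.of_compactSpace _)

theorem UniformlyEquidistributed.add {f g : C(UnitAddCircle, ℂ)}
    (hf : UniformlyEquidistributed α f) (hg : UniformlyEquidistributed α g) :
    UniformlyEquidistributed α (f + g) := by
  intro ε hε
  filter_upwards [hf (ε / 2) (by positivity), hg (ε / 2) (by positivity)] with N h1 h2 θ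
  simp only [ContinuousMap.add_apply]
  rw [integral_add (integrable_continuousMap_addCircle f) (integrable_continuousMap_addCircle g),
    Finset.sum_add_distrib, mul_add, add_sub_add_comm]
  refine (norm_add_le _ _).trans ?_
  linarith [h1 θ, h2 θ]

theorem UniformlyEquidistributed.smul {f : C(UnitAddCircle, ℂ)}
    (hf : UniformlyEquidistributed α f) (c : ℂ) : UniformlyEquidistributed α (c • f) := by
  intro ε hε
  filter_upwards [hf (ε / (‖c‖ + 1)) (by positivity)] with N h1 θ
  simp only [ContinuousMap.smul_apply, smul_eq_mul]
  rw [integral_const_mul, ← Finset.mul_sum, mul_left_comm, ← mul_sub, norm_mul]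
  have h2 : ‖c‖ * (ε / (‖c‖ + 1) * N) ≤ ε * N := by
    have : ‖c‖ * (ε / (‖c‖ + 1)) ≤ ε := by
      rw [mul_div_assoc', div_le_iff₀ (by positivity)]
      nlinarith [norm_nonneg c]
    rw [← mul_assoc]
    gcongr
  exact (mul_le_mul_of_nonneg_left (h1 θ) (norm_nonneg c)).trans h2

/-- For `k ≠ 0` the sum is geometric with ratio different from `1`, hence bounded independently of
`N` and `θ`, while the mean is zero by rotation invariance. -/
theorem uniformlyEquidistributed_fourier (hα : ¬ IsOfFinAddOrder α) (k : ℤ) :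
    UniformlyEquidistributed α (fourier k) := by
  intro ε hε
  rcases eq_or_ne k 0 with rfl | hk
  · filter_upwards with N θ
    have : (volume : Measure UnitAddCircle).real Set.univ = 1 := by simp [Measure.real]
    simp [this]
    positivity
  have hz : (fourier k α : ℂ) ≠ 1 := by
    intro h
    have h1 : AddCircle.toCircle (k • α) = 1 := by
      rw [fourier_apply] at h
      exact Subtype.ext h
    have h2 : k • α = 0 :=
      AddCircle.injective_toCircle one_ne_zero (by rw [h1, AddCircle.toCircle_zero])
    exact hα (isOfFinAddOrder_iff_zsmul_eq_zero.2 ⟨k, hk, h2⟩)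
  have hadd : ∀ x y : UnitAddCircle, (fourier k (x + y) : ℂ) = fourier k x * fourier k y := by
    intro x y
    simp only [fourier_apply, smul_add, AddCircle.toCircle_add, Circle.coe_mul]
  have hint : ∫ x : UnitAddCircle, (fourier k x : ℂ) = 0 := by
    have h1 := integral_add_right_eq_self (μ := (volume : Measure UnitAddCircle))
      (fun x => (fourier k x : ℂ)) α
    simp only [hadd] at h1
    rw [integral_mul_const] at h1
    have h2 : (∫ x : UnitAddCircle, (fourier k x : ℂ)) * (fourier k α - 1) = 0 := by
      rw [mul_sub, h1, mul_one, sub_self]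
    exact (mul_eq_zero.1 h2).resolve_right (sub_ne_zero.2 hz)
  have hpow : ∀ j : ℕ, (fourier k (j • α) : ℂ) = fourier k α ^ j := by
    intro j
    induction j with
    | zero => simp
    | succ j ih => rw [succ_nsmul, hadd, ih, pow_succ]
  have hn : ∀ x : UnitAddCircle, ‖(fourier k x : ℂ)‖ = 1 := fun x => Circle.norm_coe _
  have hbound : ∀ (N : ℕ) (θ : UnitAddCircle),
      ‖∑ j ∈ Finset.range N, (fourier k (θ + j • α) : ℂ)‖ ≤ 2 / ‖(fourier k α : ℂ) - 1‖ := by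
    intro N θ
    simp only [hadd, hpow]
    rw [← Finset.mul_sum, norm_mul, hn, one_mul, geom_sum_eq hz, norm_div]
    gcongr
    refine (norm_sub_le _ _).trans ?_
    rw [norm_pow, hn, one_pow, norm_one]
    norm_num
  filter_upwards [eventually_ge_atTop ⌈2 / ‖(fourier k α : ℂ) - 1‖ / ε⌉₊] with N hN θ
  rw [hint, mul_zero, sub_zero]
  refine (hbound N θ).trans ?_
  have := (Nat.le_ceil _).trans (Nat.cast_le (α := ℝ).2 hN)
  rwa [div_le_iff₀ hε, mul_comm] at this

/-- Weyl's argument: trigonometric polynomials are uniformly dense, and a uniform approximation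
error passes to the averages and to the mean. -/
theorem uniformlyEquidistributed_of_not_isOfFinAddOrder (hα : ¬ IsOfFinAddOrder α)
    (f : C(UnitAddCircle, ℂ)) : UniformlyEquidistributed α f := by
  have hspan : ∀ g ∈ Submodule.span ℂ (Set.range (@fourier 1)), UniformlyEquidistributed α g := by
    intro g hg
    induction hg using Submodule.span_induction with
    | mem x h => obtain ⟨k, rfl⟩ := h; exact uniformlyEquidistributed_fourier hα k
    | zero => intro ε hε; filter_upwards with N θ; simp; positivity
    | add x y _ _ hx hy => exact hx.add hy
    | smul c x _ hx => exact hx.smul c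
  intro ε hε
  have hf : f ∈ closure (Submodule.span ℂ (Set.range (@fourier 1)) : Set C(UnitAddCircle, ℂ)) := by
    rw [← Submodule.topologicalClosure_coe, span_fourier_closure_eq_top]
    trivial
  obtain ⟨g, hg, hfg⟩ := Metric.mem_closure_iff.1 hf (ε / 3) (by positivity)
  have hd : ∀ x, ‖f x - g x‖ ≤ ε / 3 := fun x => by
    rw [← dist_eq_norm]
    exact (ContinuousMap.dist_apply_le_dist x).trans hfg.le
  filter_upwards [hspan g hg (ε / 3) (by positivity)] with N hN θ
  have h1 : ‖∑ j ∈ Finset.range N, f (θ + j • α) - ∑ j ∈ Finset.range N, g (θ + j • α)‖ ≤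
      ε / 3 * N := by
    rw [← Finset.sum_sub_distrib]
    refine (norm_sum_le_of_le _ fun j _ => hd _).trans (le_of_eq ?_)
    simp [mul_comm]
  have h2 : ‖(N : ℂ) * (∫ x, g x) - (N : ℂ) * (∫ x, f x)‖ ≤ ε / 3 * N := by
    rw [← mul_sub, ← integral_sub (integrable_continuousMap_addCircle g)
      (integrable_continuousMap_addCircle f), norm_mul, Complex.norm_natCast, mul_comm]
    gcongr
    have := norm_integral_le_of_norm_le_const (μ := (volume : Measure UnitAddCircle))
      (f := fun x => g x - f x) (C := ε / 3)
      (ae_of_all _ fun x => by rw [norm_sub_rev]; exact hd x)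
    simpa [Measure.real] using this
  have h3 := hN θ
  calc _ = ‖(∑ j ∈ Finset.range N, f (θ + j • α) - ∑ j ∈ Finset.range N, g (θ + j • α)) +
        (∑ j ∈ Finset.range N, g (θ + j • α) - N * ∫ x, g x) +
        (N * (∫ x, g x) - N * (∫ x, f x))‖ := by congr 1; ring
    _ ≤ _ := (norm_add₃_le).trans (by linarith)

theorem eventually_sum_le_of_not_isOfFinAddOrder (hα : ¬ IsOfFinAddOrder α)
    {f : UnitAddCircle → ℝ} (hf : Continuous f) {ε : ℝ} (hε : 0 < ε) :
    ∀ᶠ N : ℕ in atTop, ∀ θ : UnitAddCircle,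
      ∑ j ∈ Finset.range N, f (θ + j • α) ≤ N * (∫ x, f x) + ε * N := by
  have h := uniformlyEquidistributed_of_not_isOfFinAddOrder hα
    ⟨fun x => (f x : ℂ), Complex.continuous_ofReal.comp hf⟩ ε hε
  filter_upwards [h] with N hN θ
  have := hN θ
  simp only [ContinuousMap.coe_mk] at this
  rw [integral_complex_ofReal, ← Complex.ofReal_sum, ← Complex.ofReal_natCast,
    ← Complex.ofReal_mul, ← Complex.ofReal_sub, Complex.norm_real, Real.norm_eq_abs] at this
  linarith [(abs_le.1 this).2]

end Equidistribution

/-! ### Uniform growth and phase dependence of cocycles -/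

namespace IsHolderCocycle

variable {A : ℕ → UnitAddCircle → Matrix (Fin 2) (Fin 2) ℝ} {α : UnitAddCircle} {γ C : ℝ}

theorem one_le_norm (hA : IsHolderCocycle A α γ C) (n : ℕ) (θ : UnitAddCircle) : 1 ≤ ‖A n θ‖ :=
  one_le_l2_opNorm_of_det_eq_one (hA.det_eq n θ)

theorem one_le_const (hA : IsHolderCocycle A α γ C) : 1 ≤ C :=
  (hA.one_le_norm 1 0).trans (hA.norm_le 0)

theorem zero_eq (hA : IsHolderCocycle A α γ C) (θ : UnitAddCircle) : A 0 θ = 1 := by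
  have h := hA.add 0 0 θ
  have hu : IsUnit (A 0 θ) := (Matrix.isUnit_iff_isUnit_det _).2 (by simp [hA.det_eq 0 θ])
  simp only [add_zero, zero_smul] at h
  exact (hu.mul_eq_left.1 h.symm)

theorem continuous (hA : IsHolderCocycle A α γ C) (hγ : 0 < γ) (n : ℕ) : Continuous (A n) := by
  have h1 : Continuous (A 1) := by
    refine continuous_iff_continuousAt.2 fun θ₀ => ?_
    rw [ContinuousAt, tendsto_iff_norm_sub_tendsto_zero]
    have hlim : Tendsto (fun θ : UnitAddCircle => C * ‖θ - θ₀‖ ^ γ) (𝓝 θ₀) (𝓝 0) := by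
      have : Continuous fun θ : UnitAddCircle => C * ‖θ - θ₀‖ ^ γ :=
        continuous_const.mul
          ((continuous_id.sub continuous_const).norm.rpow_const fun _ => Or.inr hγ.le)
      simpa [Real.zero_rpow hγ.ne'] using this.tendsto θ₀
    exact squeeze_zero (fun _ => norm_nonneg _) (fun θ => hA.holder θ θ₀) hlim
  induction n with
  | zero => rw [show A 0 = fun _ => 1 from funext hA.zero_eq]; exact continuous_const
  | succ n ih =>
    rw [show A (n + 1) = fun θ => A 1 (θ + n • α) * A n θ from funext (hA.add n 1)]
    exact (h1.comp (continuous_id.add continuous_const)).mul ih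

theorem continuous_log_norm (hA : IsHolderCocycle A α γ C) (hγ : 0 < γ) (n : ℕ) :
    Continuous fun θ => Real.log ‖A n θ‖ :=
  (hA.continuous hγ n).norm.log fun θ => (zero_lt_one.trans_le (hA.one_le_norm n θ)).ne'

theorem log_norm_nonneg (hA : IsHolderCocycle A α γ C) (n : ℕ) (θ : UnitAddCircle) :
    0 ≤ Real.log ‖A n θ‖ :=
  Real.log_nonneg (hA.one_le_norm n θ)

theorem log_norm_add_le (hA : IsHolderCocycle A α γ C) (m n : ℕ) (θ : UnitAddCircle) :
    Real.log ‖A (m + n) θ‖ ≤ Real.log ‖A m θ‖ + Real.log ‖A n (θ + m • α)‖ := by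
  have hp : ∀ k φ, 0 < ‖A k φ‖ := fun k φ => zero_lt_one.trans_le (hA.one_le_norm k φ)
  rw [← Real.log_mul (hp _ _).ne' (hp _ _).ne', hA.add, mul_comm]
  refine Real.log_le_log ?_ (norm_mul_le _ _)
  rw [← hA.add]
  exact hp _ _

theorem log_norm_le (hA : IsHolderCocycle A α γ C) (n : ℕ) (θ : UnitAddCircle) :
    Real.log ‖A n θ‖ ≤ n * Real.log C := by
  induction n with
  | zero => simp [hA.zero_eq]
  | succ n ih =>
    have h1 := hA.log_norm_add_le n 1 θ
    have h2 := Real.log_le_log (zero_lt_one.trans_le (hA.one_le_norm 1 (θ + n • α)))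
      (hA.norm_le _)
    push_cast
    linarith

theorem log_norm_mul_le (hA : IsHolderCocycle A α γ C) (n N : ℕ) (θ : UnitAddCircle) :
    Real.log ‖A (n * N) θ‖ ≤
      ∑ j ∈ Finset.range N, Real.log ‖A n (θ + j • (n • α))‖ := by
  induction N with
  | zero => simp [hA.zero_eq]
  | succ N ih =>
    rw [Finset.sum_range_succ, Nat.mul_succ]
    refine (hA.log_norm_add_le _ _ _).trans (add_le_add ih (le_of_eq ?_))
    rw [mul_comm, mul_smul]

theorem integrable_log_norm (hA : IsHolderCocycle A α γ C) (hγ : 0 < γ) (n : ℕ) :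
    Integrable fun θ => Real.log ‖A n θ‖ :=
  (hA.continuous_log_norm hγ n).integrable_of_hasCompactSupport
    (HasCompactSupport.of_compactSpace _)

/-- Fekete's lemma: submultiplicativity of the norm and rotation invariance make the integrals
subadditive. -/
theorem exists_tendsto_integral_log_norm (hA : IsHolderCocycle A α γ C) (hγ : 0 < γ) :
    ∃ L : ℝ, Tendsto (fun n : ℕ => (∫ θ, Real.log ‖A n θ‖) / n) atTop (𝓝 L) := by
  have hs : Subadditive fun n : ℕ => ∫ θ, Real.log ‖A n θ‖ := by
    intro m n
    beta_reduce
    rw [← integral_add_right_eq_self (μ := (volume : Measure UnitAddCircle))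
      (fun θ => Real.log ‖A n θ‖) (m • α), ← integral_add (hA.integrable_log_norm hγ m)
      ((hA.integrable_log_norm hγ n).comp_add_right _)]
    exact integral_mono (hA.integrable_log_norm hγ _) ((hA.integrable_log_norm hγ m).add
      ((hA.integrable_log_norm hγ n).comp_add_right _)) fun θ => hA.log_norm_add_le m n θ
  refine ⟨hs.lim, hs.tendsto_lim ⟨0, ?_⟩⟩
  rintro _ ⟨n, rfl⟩
  exact div_nonneg (integral_nonneg fun θ => hA.log_norm_nonneg n θ) n.cast_nonneg

/-- Uniform upper bound for the growth of the cocycle over an irrational rotation. -/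
theorem exists_norm_le_mul_exp (hA : IsHolderCocycle A α γ C) (hγ : 0 < γ)
    (hα : ¬ IsOfFinAddOrder α) {L L' : ℝ} (hLL' : L < L')
    (hL : Tendsto (fun n : ℕ => (∫ θ, Real.log ‖A n θ‖) / n) atTop (𝓝 L)) :
    ∃ K, 0 < K ∧ ∀ n θ, ‖A n θ‖ ≤ K * Real.exp (L' * n) := by
  -- A single block length `n` with mean growth below `L'` suffices: long products are cut into
  -- blocks of length `n`, whose phases move by the irrational rotation `n • α`.
  obtain ⟨n, hn, hn0⟩ := ((hL.eventually_lt_const hLL').and (eventually_gt_atTop 0)).exists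
  have hn0' : (0 : ℝ) < n := by exact_mod_cast hn0
  rw [div_lt_iff₀ hn0'] at hn
  have hα' : ¬ IsOfFinAddOrder (n • α) := fun h => hα (h.of_nsmul hn0.ne')
  -- With error `L' n - ∫ log ‖A n‖` per block, `N` blocks contribute at most `L' n N`.
  obtain ⟨N₀, hN₀⟩ := eventually_atTop.1 (eventually_sum_le_of_not_isOfFinAddOrder hα'
    (hA.continuous_log_norm hγ n) (sub_pos.2 hn))
  have hlogC : 0 ≤ Real.log C := Real.log_nonneg hA.one_le_const
  have hL'0 : 0 ≤ L' := by
    have : 0 ≤ ∫ θ, Real.log ‖A n θ‖ := integral_nonneg fun θ => hA.log_norm_nonneg n θ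
    nlinarith
  -- This absorbs both the incomplete last block and all products with fewer than `N₀` full blocks.
  set D := (n * N₀ + n) * Real.log C
  have hD : 0 ≤ D := by positivity
  refine ⟨Real.exp D, Real.exp_pos _, fun m θ => ?_⟩
  rw [← Real.exp_add, ← Real.log_le_iff_le_exp (zero_lt_one.trans_le (hA.one_le_norm m θ))]
  have hm : (n : ℝ) * (m / n : ℕ) + (m % n : ℕ) = m := by
    exact_mod_cast Nat.div_add_mod m n
  have hr : ((m % n : ℕ) : ℝ) ≤ n := by exact_mod_cast (Nat.mod_lt m hn0).le
  have hr0 : (0 : ℝ) ≤ (m % n : ℕ) := Nat.cast_nonneg _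
  by_cases hc : N₀ ≤ m / n
  · have h1 := hN₀ _ hc θ
    have h2 := hA.log_norm_mul_le n (m / n) θ
    have h3 := hA.log_norm_add_le (n * (m / n)) (m % n) θ
    have h4 := hA.log_norm_le (m % n) (θ + (n * (m / n)) • α)
    rw [Nat.div_add_mod] at h3
    have h5 : ((m % n : ℕ) : ℝ) * Real.log C ≤ D := by
      simp only [D]
      gcongr
      have : (0 : ℝ) ≤ n * N₀ := by positivity
      linarith
    have h6 : L' * m = L' * (n * (m / n : ℕ)) + L' * (m % n : ℕ) := by rw [← mul_add, hm]
    have h7 : 0 ≤ L' * ((m % n : ℕ) : ℝ) := by positivity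
    nlinarith
  · have h1 := hA.log_norm_le m θ
    have h2 : (m : ℝ) ≤ n * N₀ + n := by
      have : ((m / n : ℕ) : ℝ) ≤ N₀ := by exact_mod_cast (not_le.1 hc).le
      nlinarith
    have h3 : (m : ℝ) * Real.log C ≤ D := by simp only [D]; gcongr
    have h4 : 0 ≤ L' * (m : ℝ) := by positivity
    linarith

/-- The sum telescopes by switching the phase of one factor at a time. Each summand keeps long
products on both sides, so the uniform growth bound applies to them. -/
theorem sub_eq_sum (hA : IsHolderCocycle A α γ C) (k : ℕ) (θ θ' : UnitAddCircle) :
    A k θ - A k θ' = ∑ j ∈ Finset.range k,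
      A (k - 1 - j) (θ + (j + 1) • α) * (A 1 (θ + j • α) - A 1 (θ' + j • α)) * A j θ' := by
  have h := Finset.sum_range_sub' (fun j => A (k - j) (θ + j • α) * A j θ') k
  simp only [Nat.sub_zero, zero_smul, add_zero, hA.zero_eq, mul_one, Nat.sub_self, one_mul] at h
  rw [← h]
  refine Finset.sum_congr rfl fun j hj => ?_
  have hj' : j < k := Finset.mem_range.1 hj
  have e1 : A (k - j) (θ + j • α) = A (k - 1 - j) (θ + (j + 1) • α) * A 1 (θ + j • α) := by
    have := hA.add 1 (k - 1 - j) (θ + j • α)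
    rw [one_smul, add_assoc, ← succ_nsmul] at this
    rw [← this]
    congr 1
    omega
  have e2 : k - (j + 1) = k - 1 - j := by omega
  rw [e1, e2, hA.add j 1 θ', mul_sub, sub_mul, Matrix.mul_assoc _ _ (A j θ'),
    Matrix.mul_assoc _ _ (A j θ')]

theorem norm_sub_le (hA : IsHolderCocycle A α γ C) {K L' : ℝ} (hK : 0 < K)
    (hg : ∀ n θ, ‖A n θ‖ ≤ K * Real.exp (L' * n)) (k : ℕ) (θ θ' : UnitAddCircle) :
    ‖A k θ - A k θ'‖ ≤
      k * (K ^ 2 * C * Real.exp (-L') * Real.exp (L' * k) * ‖θ - θ'‖ ^ γ) := by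
  have hC : 0 ≤ C := zero_le_one.trans hA.one_le_const
  rw [hA.sub_eq_sum k θ θ']
  refine (norm_sum_le_of_le _ fun j hj => ?_).trans_eq (by
    rw [Finset.sum_const, Finset.card_range, nsmul_eq_mul])
  have hj' : j < k := Finset.mem_range.1 hj
  have h1 : ‖A 1 (θ + j • α) - A 1 (θ' + j • α)‖ ≤ C * ‖θ - θ'‖ ^ γ := by
    have := hA.holder (θ + j • α) (θ' + j • α)
    rwa [add_sub_add_right_eq_sub] at this
  calc _ ≤ ‖A (k - 1 - j) (θ + (j + 1) • α)‖ * ‖A 1 (θ + j • α) - A 1 (θ' + j • α)‖ *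
        ‖A j θ'‖ := (norm_mul_le _ _).trans (by gcongr; exact norm_mul_le _ _)
    _ ≤ (K * Real.exp (L' * (k - 1 - j : ℕ))) * (C * ‖θ - θ'‖ ^ γ) *
        (K * Real.exp (L' * j)) := by
      gcongr
      · exact hg _ _
      · exact hg _ _
    _ = K ^ 2 * C * (Real.exp (L' * (k - 1 - j : ℕ)) * Real.exp (L' * j)) * ‖θ - θ'‖ ^ γ := by
      ring
    _ = _ := by
      rw [mul_assoc (K ^ 2 * C) (Real.exp (-L')), ← Real.exp_add, ← Real.exp_add]
      -- The two outer products have total length `k - 1`, whence the factor `e^{-L'}`.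
      have e : L' * ((k - 1 - j : ℕ) : ℝ) + L' * j = -L' + L' * k := by
        rw [Nat.cast_sub (by omega), Nat.cast_sub (by omega)]
        push_cast
        ring
      rw [e]

end IsHolderCocycle

/-! ### The Lyapunov exponent as a limit along integers -/

section Lyapunov

variable {γ C : ℝ} {V : UnitAddCircle × UnitAddCircle → ℝ}

theorem abs_log_norm_mul_sub_le {A B : Matrix (Fin 2) (Fin 2) ℝ} {K : ℝ} (hA : A.det = 1)
    (hB : B.det = 1) (hK : ‖B‖ ≤ K) :
    |Real.log ‖B * A‖ - Real.log ‖A‖| ≤ Real.log K := by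
  have hBA : (B * A).det = 1 := by rw [Matrix.det_mul, hA, hB, one_mul]
  have pA := zero_lt_one.trans_le (one_le_l2_opNorm_of_det_eq_one hA)
  have pBA := zero_lt_one.trans_le (one_le_l2_opNorm_of_det_eq_one hBA)
  have pK : 0 < K := (zero_lt_one.trans_le (one_le_l2_opNorm_of_det_eq_one hB)).trans_le hK
  have h1 : Real.log ‖B * A‖ ≤ Real.log K + Real.log ‖A‖ := by
    rw [← Real.log_mul pK.ne' pA.ne']
    exact Real.log_le_log pBA ((norm_mul_le _ _).trans (by gcongr))
  have h2 : Real.log ‖A‖ ≤ Real.log K + Real.log ‖B * A‖ := by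
    rw [← Real.log_mul pK.ne' pBA.ne']
    refine Real.log_le_log pA ?_
    have e : A = B.adjugate * (B * A) := by
      rw [← Matrix.mul_assoc, Matrix.adjugate_mul, hB, one_smul, Matrix.one_mul]
    conv_lhs => rw [e]
    exact (norm_mul_le _ _).trans (by gcongr; exact (l2_opNorm_adjugate_le B).trans hK)
  rw [abs_le]
  constructor <;> linarith

/-- The integer limit exists by subadditivity, and passing from `⌊x⌋₊` to `x` changes the integral
by a bounded amount. So the limit over real `x` exists, and `limUnder` returns it rather than a
default value. -/
theorem tendsto_lyapunovExponent (hγ : 0 < γ) (hV : Measurable V) (hC : ∀ p, |V p| ≤ C)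
    (hh : ∀ x y z : UnitAddCircle, |V (x, y) - V (x, z)| ≤ C * ‖y - z‖ ^ γ) (ω E : ℝ) :
    Tendsto (fun n : ℕ =>
      (∫ θ : UnitAddCircle, Real.log ‖transferMatrix (quasiPotential V ω θ) E 0 n‖) / n) atTop
      (𝓝 (lyapunovExponent V ω E)) := by
  obtain ⟨D, hA⟩ := exists_isHolderCocycle hV hC hh ω E
  obtain ⟨L, hL⟩ := hA.exists_tendsto_integral_log_norm hγ
  obtain ⟨K, hK0, hK⟩ := exists_norm_transferMatrix_le E (C + |E|) 1
  have hm := measurable_quasiPotential hV ω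
  have hM := abs_quasiPotential_sub_energy_le hC E ω
  set T : ℝ → UnitAddCircle → Matrix (Fin 2) (Fin 2) ℝ :=
    fun x θ => transferMatrix (quasiPotential V ω θ) E 0 x
  set F : ℝ → ℝ := fun x => ∫ θ, Real.log ‖T x θ‖
  have hi : ∀ x, 0 ≤ x → Integrable fun θ => Real.log ‖T x θ‖ := fun x hx =>
    ((continuous_transferMatrix_quasiPotential hγ hV hC hh hx).norm.log fun θ =>
      (zero_lt_one.trans_le (one_le_l2_opNorm_of_det_eq_one
        (det_transferMatrix (hm θ) (hM θ) hx))).ne').integrable_of_hasCompactSupport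
      (HasCompactSupport.of_compactSpace _)
  have hF : ∀ x, 0 ≤ x → |F x - F ⌊x⌋₊| ≤ Real.log K := by
    intro x hx
    rw [← integral_sub (hi x hx) (hi _ (Nat.cast_nonneg _))]
    have := norm_integral_le_of_norm_le_const (μ := (volume : Measure UnitAddCircle))
      (f := fun θ => Real.log ‖T x θ‖ - Real.log ‖T ⌊x⌋₊ θ‖) (C := Real.log K)
      (ae_of_all _ fun θ => by
        have hs : 0 ≤ x - ⌊x⌋₊ := sub_nonneg.2 (Nat.floor_le hx)
        have hs' : x - ⌊x⌋₊ ≤ 1 := by linarith [Nat.lt_floor_add_one x]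
        have e := transferMatrix_quasiPotential_add (ω := ω) (E := E) hV hC θ ⌊x⌋₊ hs
        rw [add_sub_cancel] at e
        simp only [T]
        rw [e]
        exact abs_log_norm_mul_sub_le (det_transferMatrix (hm _) (hM _) (Nat.cast_nonneg _))
          (det_transferMatrix (hm _) (hM _) hs) (hK _ (hm _) (hM _) _ ⟨hs, hs'⟩))
    simpa [Measure.real] using this
  have hlim : Tendsto (fun x : ℝ => (1 / x) * F x) atTop (𝓝 L) := by
    have h1 : Tendsto (fun x : ℝ => F ⌊x⌋₊ / (⌊x⌋₊ : ℝ) * ((⌊x⌋₊ : ℝ) / x)) atTop (𝓝 (L * 1)) :=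
      (hL.comp (tendsto_nat_floor_atTop (α := ℝ))).mul tendsto_nat_floor_div_atTop
    have h2 : Tendsto (fun x : ℝ => (F x - F ⌊x⌋₊) / x) atTop (𝓝 0) := by
      refine squeeze_zero_norm' (a := fun x : ℝ => Real.log K / x) ?_
        (tendsto_const_nhds.div_atTop tendsto_id)
      filter_upwards [eventually_gt_atTop 0] with x hx
      rw [norm_div, Real.norm_of_nonneg hx.le]
      gcongr
      exact hF x hx.le
    have h3 := h1.add h2
    rw [mul_one, add_zero] at h3
    refine h3.congr' ?_
    filter_upwards [eventually_ge_atTop 1] with x hx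
    have : (0 : ℝ) < ⌊x⌋₊ := by exact_mod_cast Nat.floor_pos.2 hx
    field_simp
    ring
  have : lyapunovExponent V ω E = L := hlim.limUnder_eq
  rw [this]
  exact hL

end Lyapunov

/-! ### Near repetition of blocks from the Liouville exponent -/

section Liouville

theorem frequently_norm_nsmul_lt_exp {ω b : ℝ} (hω : ¬ IsOfFinAddOrder (ω : UnitAddCircle))
    (hb : (b : EReal) < liouvilleExponent ω) :
    ∃ᶠ k : ℕ in atTop, ‖k • (ω : UnitAddCircle)‖ < Real.exp (-(b * k)) := by
  refine ((frequently_lt_of_lt_limsup (h := hb)).and_eventually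
    (eventually_gt_atTop 0)).mono fun k ⟨hk, hk0⟩ => ?_
  have hk0' : (0 : ℝ) < k := by exact_mod_cast hk0
  have e : ((k * ω : ℝ) : UnitAddCircle) = k • (ω : UnitAddCircle) := by
    rw [← AddCircle.coe_nsmul, nsmul_eq_mul]
  rw [e] at hk
  have hpos : 0 < ‖k • (ω : UnitAddCircle)‖ := norm_pos_iff.2 fun h =>
    hω (isOfFinAddOrder_iff_nsmul_eq_zero.2 ⟨k, hk0, h⟩)
  rw [ENNReal.log_ofReal_of_pos hpos, ← EReal.coe_neg, ← EReal.coe_div, EReal.coe_lt_coe_iff,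
    lt_div_iff₀ hk0'] at hk
  rw [← Real.log_lt_iff_lt_exp hpos]
  linarith

theorem exists_real_btwn_of_lt_mul {L γ : ℝ} (hγ : 0 < γ) {β : EReal}
    (h : (L : EReal) < (γ : EReal) * β) : ∃ b : ℝ, L < γ * b ∧ (b : EReal) < β := by
  have h1 : ((L / γ : ℝ) : EReal) < β := by
    induction β with
    | bot => rw [EReal.coe_mul_bot_of_pos hγ] at h; exact absurd h not_lt_bot
    | top => exact EReal.coe_lt_top _
    | coe r =>
      rw [← EReal.coe_mul, EReal.coe_lt_coe_iff] at h
      rw [EReal.coe_lt_coe_iff, div_lt_iff₀ hγ]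
      linarith
  obtain ⟨b, hb1, hb2⟩ := EReal.lt_iff_exists_real_btwn.1 h1
  rw [EReal.coe_lt_coe_iff, div_lt_iff₀ hγ] at hb1
  exact ⟨b, by linarith, hb2⟩

/-- Requiring only `‖s‖ = ‖kω‖` treats the forward phase `kω` and the backward phase `-kω` together.
-/
theorem IsHolderCocycle.frequently_norm_sub_le
    {A : ℕ → UnitAddCircle → Matrix (Fin 2) (Fin 2) ℝ} {γ C ω L b : ℝ}
    (hA : IsHolderCocycle A (ω : UnitAddCircle) γ C) (hγ : 0 < γ)
    (hL : Tendsto (fun n : ℕ => (∫ θ, Real.log ‖A n θ‖) / n) atTop (𝓝 L))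
    (hLb : L < γ * b) (hb : (b : EReal) < liouvilleExponent ω) {ε : ℝ} (hε : 0 < ε) :
    ∃ᶠ k : ℕ in atTop, ∀ s : UnitAddCircle, ‖s‖ = ‖k • (ω : UnitAddCircle)‖ →
      ‖A k s - A k 0‖ ≤ ε := by
  by_cases hω : IsOfFinAddOrder (ω : UnitAddCircle)
  · obtain ⟨N, hN, hN'⟩ := isOfFinAddOrder_iff_nsmul_eq_zero.1 hω
    -- At multiples of the period `kω = 0`, so the difference is zero.
    refine frequently_atTop.2 fun a => ⟨a * N, Nat.le_mul_of_pos_right a hN, fun s hs => ?_⟩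
    rw [mul_smul, hN', smul_zero, norm_zero, norm_eq_zero] at hs
    rw [hs, sub_self, norm_zero]
    exact hε.le
  · obtain ⟨L', hLL', hL'b⟩ := exists_between hLb
    obtain ⟨K, hK, hg⟩ := hA.exists_norm_le_mul_exp hγ hω hLL' hL
    have hC : 0 < C := zero_lt_one.trans_le hA.one_le_const
    set D := K ^ 2 * C * Real.exp (-L')
    have hD : 0 < D := by positivity
    -- Growth `e^{L'k}` loses against `‖kω‖^γ ≤ e^{-γbk}` because `L' < γb`.
    have hlim : Tendsto (fun k : ℕ => D * ((k : ℝ) ^ (1 : ℝ) * Real.exp (-(γ * b - L') * k)))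
        atTop (𝓝 0) := by
      have := (tendsto_rpow_mul_exp_neg_mul_atTop_nhds_zero 1 (γ * b - L')
        (sub_pos.2 hL'b)).comp tendsto_natCast_atTop_atTop
      simpa using this.const_mul D
    refine ((frequently_norm_nsmul_lt_exp hω hb).and_eventually
      (hlim.eventually_le_const hε)).mono fun k ⟨hk, hk'⟩ s hs => ?_
    refine (hA.norm_sub_le hK hg k s 0).trans (le_trans ?_ hk')
    rw [sub_zero, hs, Real.rpow_one]
    have h1 : ‖k • (ω : UnitAddCircle)‖ ^ γ ≤ Real.exp (-(γ * b * k)) := by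
      refine (Real.rpow_le_rpow (norm_nonneg _) hk.le hγ.le).trans (le_of_eq ?_)
      rw [← Real.exp_mul]
      ring_nf
    calc _ ≤ k * (D * Real.exp (L' * k) * Real.exp (-(γ * b * k))) := by gcongr
      _ = D * (k * (Real.exp (L' * k) * Real.exp (-(γ * b * k)))) := by ring
      _ = _ := by rw [← Real.exp_add]; ring_nf

end Liouville

/-! ### Reduction to real eigenfunctions -/

section RealParts

theorem AbsolutelyContinuousOnInterval.of_dist_le {X Y : Type*} [PseudoMetricSpace X]
    [PseudoMetricSpace Y] {f : ℝ → X} {g : ℝ → Y} {a b : ℝ}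
    (hf : AbsolutelyContinuousOnInterval f a b) (h : ∀ x y, dist (g x) (g y) ≤ dist (f x) (f y)) :
    AbsolutelyContinuousOnInterval g a b :=
  squeeze_zero (fun _ => Finset.sum_nonneg fun _ _ => dist_nonneg)
    (fun _ => Finset.sum_le_sum fun _ _ => h _ _) hf

theorem ae_differentiableAt_of_forall_absolutelyContinuousOnInterval {f : ℝ → ℝ}
    (hf : ∀ a b, AbsolutelyContinuousOnInterval f a b) : ∀ᵐ x, DifferentiableAt ℝ f x := by
  have h : ∀ᵐ x, ∀ n : ℕ, x ∈ Set.uIcc (-(n : ℝ)) n → DifferentiableAt ℝ f x :=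
    ae_all_iff.2 fun n => (hf (-(n : ℝ)) n).ae_differentiableAt
  filter_upwards [h] with x hx
  obtain ⟨n, hn⟩ := exists_nat_ge |x|
  refine hx n ?_
  rw [Set.uIcc_of_le (by linarith [abs_nonneg x])]
  exact abs_le.1 hn

theorem IsSolution.re_im {W : ℝ → ℝ} {E : ℝ} {u : ℝ → ℂ} (hu : IsSolution W E u) :
    IsSolution W E (fun x => (u x).re) ∧ IsSolution W E (fun x => (u x).im) := by
  have dre : ∀ x, HasDerivAt (fun x => (u x).re) (deriv u x).re x := fun x =>
    Complex.reCLM.hasFDerivAt.comp_hasDerivAt x (hu.differentiable x).hasDerivAt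
  have dim : ∀ x, HasDerivAt (fun x => (u x).im) (deriv u x).im x := fun x =>
    Complex.imCLM.hasFDerivAt.comp_hasDerivAt x (hu.differentiable x).hasDerivAt
  have ere : deriv (fun x => (u x).re) = fun x => (deriv u x).re := funext fun x => (dre x).deriv
  have eim : deriv (fun x => (u x).im) = fun x => (deriv u x).im := funext fun x => (dim x).deriv
  have are : ∀ a b, AbsolutelyContinuousOnInterval (fun x => (deriv u x).re) a b := fun a b =>
    (hu.deriv_ac a b).of_dist_le fun x y => by
      rw [Real.dist_eq, Complex.dist_eq, ← Complex.sub_re]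
      exact Complex.abs_re_le_norm _
  have aim : ∀ a b, AbsolutelyContinuousOnInterval (fun x => (deriv u x).im) a b := fun a b =>
    (hu.deriv_ac a b).of_dist_le fun x y => by
      rw [Real.dist_eq, Complex.dist_eq, ← Complex.sub_im]
      exact Complex.abs_im_le_norm _
  -- Where `deriv u` is not differentiable `deriv` defaults to `0`, so splitting into parts needs
  -- almost everywhere differentiability, which absolute continuity provides.
  have key : ∀ᵐ x, deriv (deriv u) x = ((deriv (fun x => (deriv u x).re) x : ℝ) : ℂ) +
      ((deriv (fun x => (deriv u x).im) x : ℝ) : ℂ) * Complex.I := by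
    filter_upwards [ae_differentiableAt_of_forall_absolutelyContinuousOnInterval are,
      ae_differentiableAt_of_forall_absolutelyContinuousOnInterval aim] with x hr hi
    have h := hr.hasDerivAt.ofReal_comp.add (hi.hasDerivAt.ofReal_comp.mul_const Complex.I)
    have e : deriv u = (fun x => ((deriv u x).re : ℂ)) +
        fun x => ((deriv u x).im : ℂ) * Complex.I :=
      funext fun x => (Complex.re_add_im _).symm
    conv_lhs => rw [e]
    exact h.deriv
  constructor
  · refine ⟨fun x => (dre x).differentiableAt, by rw [ere]; exact are, ?_⟩
    filter_upwards [key, hu.equation] with x hx he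
    rw [ere]
    rw [hx] at he
    have := congrArg Complex.re he
    simpa using this
  · refine ⟨fun x => (dim x).differentiableAt, by rw [eim]; exact aim, ?_⟩
    filter_upwards [key, hu.equation] with x hx he
    rw [eim]
    rw [hx] at he
    have := congrArg Complex.im he
    simpa using this

theorem IsSchrodingerEigenvalue.exists_real {W : ℝ → ℝ} {E : ℝ}
    (h : IsSchrodingerEigenvalue W E) :
    ∃ u : ℝ → ℝ, IsSolution W E u ∧ MemLp u 2 volume ∧ u ≠ 0 := by
  obtain ⟨u, hu, hL, h0⟩ := h
  by_cases hre : (fun x => (u x).re) = 0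
  · refine ⟨fun x => (u x).im, hu.re_im.2, hL.im, fun him => h0 ?_⟩
    ext x
    exact Complex.ext (congrFun hre x) (congrFun him x)
  · exact ⟨fun x => (u x).re, hu.re_im.1, hL.re, hre⟩

end RealParts

/-! ### Decay of square-integrable solutions -/

section Decay

variable {W : ℝ → ℝ} {E M : ℝ} {u : ℝ → ℝ}

/-- On `[0, 1]` the solution differs from its tangent line at `0` by at most `M` times its `L¹`
norm, and an affine function is determined by its integrals over the two halves. Applied to
translates, this also controls the derivative by the local size of `u`. -/
theorem IsSolution.abs_initial_le (hM : ∀ t, |W t - E| ≤ M) (hu : IsSolution W E u) :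
    |u 0| + |deriv u 0| ≤ 12 * (1 + M) * ∫ t in (0 : ℝ)..1, |u t| := by
  set c := ∫ t in (0 : ℝ)..1, |u t|
  have hM0 : 0 ≤ M := (abs_nonneg _).trans (hM 0)
  have hmono : ∀ p q, 0 ≤ p → p ≤ q → q ≤ 1 → ∫ t in p..q, |u t| ≤ c := fun p q hp hpq hq =>
    intervalIntegral.integral_mono_interval hp hpq hq (ae_of_all _ fun t => abs_nonneg _)
      (hu.continuous.abs.intervalIntegrable _ _)
  have hd : ∀ x ∈ Set.Icc (0 : ℝ) 1, |deriv u x - deriv u 0| ≤ M * c := by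
    intro x hx
    rw [hu.deriv_eq 0 x, add_sub_cancel_left]
    exact (abs_integral_mul_le hx.1 hM hu.continuous).trans
      (mul_le_mul_of_nonneg_left (hmono 0 x le_rfl hx.1 hx.2) hM0)
  have hl : ∀ x ∈ Set.Icc (0 : ℝ) 1, |u 0 + x * deriv u 0| ≤ |u x| + M * c := by
    intro x hx
    have h1 : u x - (u 0 + x * deriv u 0) = ∫ t in (0 : ℝ)..x, (deriv u t - deriv u 0) := by
      rw [intervalIntegral.integral_sub (hu.continuous_deriv.intervalIntegrable _ _)
        (continuous_const.intervalIntegrable _ _), intervalIntegral.integral_const,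
        hu.apply_eq 0 x]
      simp
    have h2 : |u x - (u 0 + x * deriv u 0)| ≤ M * c := by
      rw [h1, ← Real.norm_eq_abs]
      have := intervalIntegral.norm_integral_le_of_norm_le_const (a := 0) (b := x)
        (f := fun t => deriv u t - deriv u 0) (C := M * c) (fun t ht => by
          rw [Set.uIoc_of_le hx.1] at ht
          exact hd t ⟨ht.1.le, ht.2.trans hx.2⟩)
      refine this.trans ?_
      rw [sub_zero, abs_of_nonneg hx.1]
      exact mul_le_of_le_one_right ((abs_nonneg _).trans (hd 0 ⟨le_rfl, zero_le_one⟩)) hx.2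
    have h3 := _root_.abs_sub_le 0 (u x) (u 0 + x * deriv u 0)
    simp only [zero_sub, abs_neg] at h3
    linarith
  have hint : ∀ p q, 0 ≤ p → p ≤ q → q ≤ 1 →
      |∫ t in p..q, (u 0 + t * deriv u 0)| ≤ (1 + M) * c := by
    intro p q hp hpq hq
    have hMc : 0 ≤ M * c := (abs_nonneg _).trans (hd 0 ⟨le_rfl, zero_le_one⟩)
    have h1 : |∫ t in p..q, (u 0 + t * deriv u 0)| ≤ ∫ t in p..q, (|u t| + M * c) := by
      rw [← Real.norm_eq_abs]
      refine intervalIntegral.norm_integral_le_of_norm_le hpq (ae_of_all _ fun t ht => ?_)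
        ((hu.continuous.abs.add continuous_const).intervalIntegrable (μ := volume) _ _)
      exact hl t ⟨by linarith [ht.1], by linarith [ht.2]⟩
    rw [intervalIntegral.integral_add (hu.continuous.abs.intervalIntegrable _ _)
      (continuous_const.intervalIntegrable _ _), intervalIntegral.integral_const,
      smul_eq_mul] at h1
    have h2 := hmono p q hp hpq hq
    have h3 : (q - p) * (M * c) ≤ M * c := mul_le_of_le_one_left hMc (by linarith)
    linarith
  have hcomp : ∀ p q : ℝ, ∫ t in p..q, (u 0 + t * deriv u 0) =
      (q - p) * u 0 + (q ^ 2 - p ^ 2) / 2 * deriv u 0 := by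
    intro p q
    rw [intervalIntegral.integral_add (continuous_const.intervalIntegrable _ _)
      ((by fun_prop : Continuous fun t : ℝ => t * deriv u 0).intervalIntegrable _ _),
      intervalIntegral.integral_const, intervalIntegral.integral_mul_const, integral_id,
      smul_eq_mul]
  -- With `I₁`, `I₂` the integrals of the tangent line over the halves, `u 0 = 3 I₁ - I₂` and `u' 0
  -- = 4 (I₂ - I₁)`; the coefficients add up to `4 + 8 = 12`.
  have b1 := hint 0 (1 / 2) le_rfl (by norm_num) (by norm_num)
  have b2 := hint (1 / 2) 1 (by norm_num) (by norm_num) le_rfl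
  rw [hcomp] at b1 b2
  rw [_root_.abs_le] at b1 b2
  rcases abs_cases (u 0) with h1 | h1 <;> rcases abs_cases (deriv u 0) with h2 | h2 <;>
    linarith [b1.1, b1.2, b2.1, b2.2]

theorem integral_abs_le_sqrt {u : ℝ → ℝ} (hu : Continuous u) (x : ℝ) :
    ∫ t in x..x + 1, |u t| ≤ √(∫ t in x..x + 1, u t ^ 2) := by
  set c := ∫ t in x..x + 1, |u t|
  -- Cauchy–Schwarz on an interval of length one, as nonnegativity of the variance.
  have h1 : 0 ≤ ∫ t in x..x + 1, (|u t| - c) ^ 2 :=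
    intervalIntegral.integral_nonneg (by linarith) fun t _ => sq_nonneg _
  have h2 : (fun t => (|u t| - c) ^ 2) = fun t => u t ^ 2 - 2 * c * |u t| + c ^ 2 := by
    ext t
    rw [sub_sq, sq_abs]
    ring
  have i1 : IntervalIntegrable (fun t => u t ^ 2) volume x (x + 1) :=
    (hu.pow 2).intervalIntegrable _ _
  have i2 : IntervalIntegrable (fun t => 2 * c * |u t|) volume x (x + 1) :=
    (continuous_const.mul hu.abs).intervalIntegrable _ _
  rw [h2, intervalIntegral.integral_add (i1.sub i2) (continuous_const.intervalIntegrable _ _),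
    intervalIntegral.integral_sub i1 i2, intervalIntegral.integral_const_mul,
    intervalIntegral.integral_const] at h1
  refine Real.le_sqrt_of_sq_le ?_
  have e : (∫ t in x..x + 1, |u t|) = c := rfl
  rw [e] at h1
  simp only [add_sub_cancel_left, one_smul] at h1
  linarith

theorem tendsto_integral_add_one {f : ℝ → ℝ} (hf : Integrable f) :
    Tendsto (fun x => ∫ t in x..x + 1, f t) atTop (𝓝 0) ∧
      Tendsto (fun x => ∫ t in x..x + 1, f t) atBot (𝓝 0) := by
  constructor
  · have h1 := intervalIntegral_tendsto_integral_Ioi 0 hf.integrableOn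
      (tendsto_id (α := ℝ) (x := atTop))
    have h2 := intervalIntegral_tendsto_integral_Ioi 0 hf.integrableOn
      (tendsto_atTop_add_const_right atTop (1 : ℝ) tendsto_id)
    have h3 := h2.sub h1
    rw [sub_self] at h3
    refine h3.congr fun x => ?_
    exact intervalIntegral.integral_interval_sub_left hf.intervalIntegrable hf.intervalIntegrable
  · have h1 := intervalIntegral_tendsto_integral_Iic 0 hf.integrableOn
      (tendsto_id (α := ℝ) (x := atBot))
    have h2 := intervalIntegral_tendsto_integral_Iic 0 hf.integrableOn
      (tendsto_atBot_add_const_right atBot (1 : ℝ) tendsto_id)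
    have h3 := h1.sub h2
    rw [sub_self] at h3
    refine h3.congr fun x => ?_
    rw [sub_eq_iff_eq_add]
    exact (intervalIntegral.integral_add_adjacent_intervals hf.intervalIntegrable
      hf.intervalIntegrable).symm

theorem IsSolution.tendsto_zero (hW : Measurable W) (hM : ∀ t, |W t - E| ≤ M)
    (hu : IsSolution W E u) (hL : MemLp u 2 volume) :
    Tendsto (fun x => |u x| + |deriv u x|) atTop (𝓝 0) ∧
      Tendsto (fun x => |u x| + |deriv u x|) atBot (𝓝 0) := by
  have hM0 : 0 ≤ M := (abs_nonneg _).trans (hM 0)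
  have hb : ∀ x, |u x| + |deriv u x| ≤ 12 * (1 + M) * √(∫ t in x..x + 1, u t ^ 2) := by
    intro x
    have h := (hu.comp_add_right hW hM x).abs_initial_le (fun t => hM (t + x))
    rw [deriv_comp_add_const, zero_add,
      intervalIntegral.integral_comp_add_right (fun t => |u t|) x, zero_add, add_comm 1 x] at h
    exact h.trans (by gcongr; exact integral_abs_le_sqrt hu.continuous x)
  have hi := tendsto_integral_add_one hL.integrable_sq
  have hs : ∀ l : Filter ℝ, Tendsto (fun x => ∫ t in x..x + 1, u t ^ 2) l (𝓝 0) →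
      Tendsto (fun x => |u x| + |deriv u x|) l (𝓝 0) := by
    intro l hl
    refine squeeze_zero (fun x => by positivity) hb ?_
    have := ((Real.continuous_sqrt.tendsto 0).comp hl).const_mul (12 * (1 + M))
    simpa using this
  exact ⟨hs _ hi.1, hs _ hi.2⟩

end Decay

/-! ### Gordon's estimate -/

section Gordon

theorem norm_toLp_mulVec_le (A : Matrix (Fin 2) (Fin 2) ℝ) (x : Fin 2 → ℝ) :
    ‖WithLp.toLp 2 (A.mulVec x)‖ ≤ ‖A‖ * ‖WithLp.toLp 2 x‖ :=
  A.l2_opNorm_mulVec (WithLp.toLp 2 x)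

theorem norm_toLp_fin_two_le (a b : ℝ) : ‖WithLp.toLp 2 ![a, b]‖ ≤ |b| + |a| := by
  rw [EuclideanSpace.norm_eq, Real.sqrt_le_left (by positivity)]
  simp only [Fin.sum_univ_two, Real.norm_eq_abs, sq_abs, Matrix.cons_val_zero,
    Matrix.cons_val_one]
  nlinarith [sq_abs a, sq_abs b, mul_nonneg (abs_nonneg a) (abs_nonneg b)]

/-- The two-sided Gordon estimate for three consecutive transfer matrices `B'`, `A`, `B`. -/
theorem gordon_estimate {A B B' : Matrix (Fin 2) (Fin 2) ℝ} (hA : A.det = 1) (hB' : B'.det = 1)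
    {v w : Fin 2 → ℝ} (hw : B'.mulVec w = v) :
    ‖WithLp.toLp 2 v‖ ≤ ‖WithLp.toLp 2 (A.mulVec v)‖ +
      ‖WithLp.toLp 2 (B.mulVec (A.mulVec v))‖ + ‖B - A‖ * ‖WithLp.toLp 2 (A.mulVec v)‖ +
      ‖WithLp.toLp 2 w‖ + ‖B' - A‖ * ‖WithLp.toLp 2 v‖ := by
  have n1 := norm_nonneg (WithLp.toLp 2 (A.mulVec v))
  have n2 := norm_nonneg (WithLp.toLp 2 (B.mulVec (A.mulVec v)))
  have n3 := norm_nonneg (WithLp.toLp 2 w)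
  have n4 := norm_nonneg (WithLp.toLp 2 v)
  have n5 := mul_nonneg (norm_nonneg (B - A)) n1
  have n6 := mul_nonneg (norm_nonneg (B' - A)) n4
  have hCH : A + A.adjugate = A.trace • (1 : Matrix (Fin 2) (Fin 2) ℝ) := by
    rw [Matrix.adjugate_fin_two, Matrix.trace_fin_two]
    ext i j
    fin_cases i <;> fin_cases j <;> simp [add_comm]
  -- For small trace, `v = tr A • A v - A² v` looks forward, with `B A v` replacing `A² v`. For
  -- large trace, `tr A • v = A v + A⁻¹ v` looks backward, with `w = B'⁻¹ v` replacing `A⁻¹ v`.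
  rcases le_total |A.trace| 1 with ht | ht
  · have h1 : v = A.trace • A.mulVec v -
        (B.mulVec (A.mulVec v) - (B - A).mulVec (A.mulVec v)) := by
      have h2 : A * A + 1 = A.trace • A := by
        have := congrArg (· * A) hCH
        simp only [add_mul, Matrix.adjugate_mul, hA, one_smul, smul_mul_assoc, one_mul] at this
        exact this
      have h3 := congrArg (fun X : Matrix (Fin 2) (Fin 2) ℝ => X.mulVec v) h2
      simp only [Matrix.add_mulVec, Matrix.one_mulVec, Matrix.smul_mulVec,
        ← Matrix.mulVec_mulVec] at h3
      rw [Matrix.sub_mulVec, ← h3]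
      abel
    have h4 : ‖WithLp.toLp 2 v‖ ≤ ‖WithLp.toLp 2 (A.mulVec v)‖ +
        (‖WithLp.toLp 2 (B.mulVec (A.mulVec v))‖ + ‖B - A‖ * ‖WithLp.toLp 2 (A.mulVec v)‖) := by
      conv_lhs => rw [h1]
      rw [WithLp.toLp_sub, WithLp.toLp_sub, WithLp.toLp_smul]
      refine (norm_sub_le _ _).trans (add_le_add ?_ ((norm_sub_le _ _).trans
        (add_le_add le_rfl (norm_toLp_mulVec_le _ _))))
      rw [norm_smul, Real.norm_eq_abs]
      exact mul_le_of_le_one_left n1 ht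
    linarith
  · have h1 : A.trace • v = A.mulVec v + (w - (B' - A).adjugate.mulVec v) := by
      have h3 := congrArg (fun X : Matrix (Fin 2) (Fin 2) ℝ => X.mulVec v) hCH
      simp only [Matrix.add_mulVec, Matrix.one_mulVec, Matrix.smul_mulVec] at h3
      have h4 : B'.adjugate.mulVec v = w := by
        rw [← hw, Matrix.mulVec_mulVec, Matrix.adjugate_mul, hB', one_smul, Matrix.one_mulVec]
      have h5 : (B' - A).adjugate = B'.adjugate - A.adjugate := by
        rw [Matrix.adjugate_fin_two, Matrix.adjugate_fin_two, Matrix.adjugate_fin_two]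
        ext i j
        fin_cases i <;> fin_cases j <;> simp [neg_add_eq_sub]
      rw [h5, Matrix.sub_mulVec, h4, ← h3]
      abel
    have h2 : ‖WithLp.toLp 2 v‖ ≤ ‖WithLp.toLp 2 (A.mulVec v)‖ +
        (‖WithLp.toLp 2 w‖ + ‖B' - A‖ * ‖WithLp.toLp 2 v‖) := by
      have h3 : ‖WithLp.toLp 2 v‖ ≤ ‖WithLp.toLp 2 (A.trace • v)‖ := by
        rw [WithLp.toLp_smul, norm_smul, Real.norm_eq_abs]
        exact le_mul_of_one_le_left n4 ht
      refine h3.trans ?_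
      rw [h1, WithLp.toLp_add, WithLp.toLp_sub]
      refine (norm_add_le _ _).trans (add_le_add le_rfl ((norm_sub_le _ _).trans
        (add_le_add le_rfl ((norm_toLp_mulVec_le _ _).trans ?_))))
      gcongr
      exact l2_opNorm_adjugate_le _
    linarith

end Gordon

/-! ### Solution data at integers and conclusion -/

section IntegerData

variable {C ω E : ℝ} {V : UnitAddCircle × UnitAddCircle → ℝ} {u : ℝ → ℝ}

theorem transferMatrix_mulVec_int (hV : Measurable V) (hC : ∀ p, |V p| ≤ C)
    (hu : IsSolution (quasiPotential V ω 0) E u) (n : ℤ) (k : ℕ) :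
    (transferMatrix (quasiPotential V ω (n • (ω : UnitAddCircle))) E 0 k).mulVec
      ![deriv u n, u n] = ![deriv u ((n + k : ℤ) : ℝ), u ((n + k : ℤ) : ℝ)] := by
  have hs := hu.comp_add_right (measurable_quasiPotential hV ω 0)
    (abs_quasiPotential_sub_energy_le hC E ω 0) n
  have e : (fun t : ℝ => quasiPotential V ω 0 (t + n)) =
      quasiPotential V ω (n • (ω : UnitAddCircle)) := by
    ext t
    rw [quasiPotential_add_int, zero_add]
  rw [e] at hs
  have h := isTransferMatrix_transferMatrix (measurable_quasiPotential hV ω _)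
    (abs_quasiPotential_sub_energy_le hC E ω _) (Nat.cast_nonneg k) _ hs
  rw [deriv_comp_add_const, deriv_comp_add_const, zero_add] at h
  rw [h]
  push_cast
  rw [add_comm (k : ℝ)]

theorem IsSolution.initial_ne_zero (hV : Measurable V) (hC : ∀ p, |V p| ≤ C)
    (hu : IsSolution (quasiPotential V ω 0) E u) (h0 : u ≠ 0) : ![deriv u 0, u 0] ≠ 0 := by
  intro hz
  refine h0 (funext fun x => ?_)
  -- Uniqueness is available only forward in time, so zero data are first carried back to `-n ≤ x`
  -- by an invertible transfer matrix.
  obtain ⟨n, hn⟩ := exists_nat_ge (-x)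
  have h1 := transferMatrix_mulVec_int hV hC hu (-(n : ℤ)) n
  rw [neg_add_cancel, Int.cast_zero, hz] at h1
  have h2 : ![deriv u ((-(n : ℤ) : ℤ) : ℝ), u ((-(n : ℤ) : ℤ) : ℝ)] = 0 := by
    refine Matrix.eq_zero_of_mulVec_eq_zero ?_ h1
    rw [det_transferMatrix (measurable_quasiPotential hV ω _)
      (abs_quasiPotential_sub_energy_le hC E ω _) (Nat.cast_nonneg n)]
    exact one_ne_zero
  have h3 := congrFun h2 0
  have h4 := congrFun h2 1
  simp only [Matrix.cons_val_zero, Matrix.cons_val_one, Pi.zero_apply, Int.cast_neg,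
    Int.cast_natCast] at h3 h4
  have hM := abs_quasiPotential_sub_energy_le hC E ω 0
  have hs := hu.comp_add_right (measurable_quasiPotential hV ω 0) hM (-(n : ℝ))
  have := hs.eq_zero_of_nonneg (fun t => hM (t + -(n : ℝ))) (by rw [zero_add]; exact h4)
    (by rw [deriv_comp_add_const, zero_add]; exact h3) (x := x + n) (by linarith)
  simpa using this.1

end IntegerData

theorem mainTheorem1 (γ : ℝ) (hγ : 0 < γ) (ω : ℝ) (V : UnitAddCircle × UnitAddCircle → ℝ)
    (hV : PiecewiseHolder γ V) (E : ℝ)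
    (hE : (lyapunovExponent V ω E : EReal) < (γ : EReal) * liouvilleExponent ω) :
    ¬ IsSchrodingerEigenvalue (quasiPotential V ω 0) E := by
  intro hev
  obtain ⟨u, hu, hL2, hu0⟩ := hev.exists_real
  obtain ⟨C, -, hC, hh⟩ := hV.exists_holder hγ
  have hVm := hV.1
  obtain ⟨b, hLb, hb⟩ := exists_real_btwn_of_lt_mul hγ hE
  obtain ⟨D, hA⟩ := exists_isHolderCocycle hVm hC hh ω E
  have hfreq := hA.frequently_norm_sub_le hγ (tendsto_lyapunovExponent hγ hVm hC hh ω E) hLb hb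
    (ε := 1 / 2) (by norm_num)
  set A : ℕ → UnitAddCircle → Matrix (Fin 2) (Fin 2) ℝ :=
    fun n θ => transferMatrix (quasiPotential V ω θ) E 0 n
  set Φ : ℤ → Fin 2 → ℝ := fun n => ![deriv u n, u n]
  have hΦ : ∀ (n : ℤ) (k : ℕ), (A k (n • (ω : UnitAddCircle))).mulVec (Φ n) = Φ (n + k) :=
    transferMatrix_mulVec_int hVm hC hu
  set N : ℤ → ℝ := fun n => ‖WithLp.toLp 2 (Φ n)‖
  have hN0 : 0 < N 0 := by
    refine norm_pos_iff.2 fun h => hu.initial_ne_zero hVm hC hu0 ?_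
    have := (WithLp.toLp_eq_zero 2).1 h
    simpa [Φ] using this
  have hlim := hu.tendsto_zero (measurable_quasiPotential hVm ω 0)
    (abs_quasiPotential_sub_energy_le hC E ω 0) hL2
  have hNle : ∀ n : ℤ, N n ≤ |u n| + |deriv u n| := fun n => norm_toLp_fin_two_le _ _
  have hpos : Tendsto (fun k : ℕ => N k) atTop (𝓝 0) :=
    squeeze_zero (fun _ => norm_nonneg _) (fun k => hNle k)
      (hlim.1.comp (tendsto_intCast_atTop_atTop.comp tendsto_natCast_atTop_atTop))
  have hneg : Tendsto (fun k : ℕ => N (-(k : ℤ))) atTop (𝓝 0) :=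
    squeeze_zero (fun _ => norm_nonneg _) (fun k => hNle _)
      (hlim.2.comp (g := fun x => |u x| + |deriv u x|) (by
        simpa using tendsto_natCast_atTop_atTop (R := ℝ) :
          Tendsto (fun k : ℕ => ((-(k : ℤ) : ℤ) : ℝ)) atTop atBot))
  have hdbl : Tendsto (fun k : ℕ => N ((k + k : ℕ) : ℤ)) atTop (𝓝 0) :=
    hpos.comp (tendsto_id.atTop_add_atTop tendsto_id)
  -- Gordon's estimate with both errors at most `1 / 2` gives the reverse inequality: `3 / 2` is `1
  -- + 1 / 2` at `k`, and `1 / 2 * N 0` is what remains after absorbing the backward error.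
  have hev1 : ∀ᶠ k : ℕ in atTop,
      3 / 2 * N k + N ((k + k : ℕ) : ℤ) + N (-(k : ℤ)) < 1 / 2 * N 0 := by
    have := ((hpos.const_mul (3 / 2)).add hdbl).add hneg
    rw [mul_zero, add_zero, add_zero] at this
    exact this.eventually_lt_const (by positivity)
  obtain ⟨k, hk, hk'⟩ := (hfreq.and_eventually hev1).exists
  have e0 : (A k 0).mulVec (Φ 0) = Φ k := by simpa using hΦ 0 k
  have e1 : (A k (k • (ω : UnitAddCircle))).mulVec (Φ k) = Φ ((k + k : ℕ) : ℤ) := by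
    simpa using hΦ k k
  have e2 : (A k (-(k • (ω : UnitAddCircle)))).mulVec (Φ (-(k : ℤ))) = Φ 0 := by
    simpa using hΦ (-(k : ℤ)) k
  have hg := gordon_estimate (B := A k (k • (ω : UnitAddCircle))) (hA.det_eq k 0)
    (hA.det_eq k (-(k • (ω : UnitAddCircle)))) e2
  change ‖WithLp.toLp 2 (Φ 0)‖ ≤ ‖WithLp.toLp 2 ((A k 0).mulVec (Φ 0))‖ +
    ‖WithLp.toLp 2 ((A k (k • (ω : UnitAddCircle))).mulVec ((A k 0).mulVec (Φ 0)))‖ +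
    ‖A k (k • (ω : UnitAddCircle)) - A k 0‖ * ‖WithLp.toLp 2 ((A k 0).mulVec (Φ 0))‖ +
    ‖WithLp.toLp 2 (Φ (-(k : ℤ)))‖ +
    ‖A k (-(k • (ω : UnitAddCircle))) - A k 0‖ * ‖WithLp.toLp 2 (Φ 0)‖ at hg
  rw [e0, e1] at hg
  have b1 := mul_le_mul_of_nonneg_right (hk _ rfl) (norm_nonneg (WithLp.toLp 2 (Φ k)))
  have b2 := mul_le_mul_of_nonneg_right (hk _ (norm_neg _)) (norm_nonneg (WithLp.toLp 2 (Φ 0)))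
  simp only [N] at hk'
  linarith
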